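/- \textbf{Setting.} Let $X_1,X_2,\dots$ be i.i.d. centered, square-integrable random vectors in $\mathbb{R}^p$ with positive definite covariance matrix $C$, and let $\varepsilon_1,\varepsilon_2,\dots$ be i.i.d. centered real random variables with variance $\sigma^2\in(0,\infty)$, the sequence $(X_i)$ being independent of the sequence $(\varepsilon_i)$. With $X^{(n)}$ the $n\times p$ matrix with rows $X_1,\dots,X_n$ and $\varepsilon^{(n)}=(\varepsilon_1,\dots,\varepsilon_n)^T$, put $C_n=\frac1n X^{(n)T}X^{(n)}$ and $W_n=\frac1{\sqrt n}X^{(n)T}\varepsilon^{(n)}$. Let $N\ge 1$, $v_1,\dots,v_N\in\mathbb{R}^p$, let $g:\mathbb{R}^p\to\mathbb{R}$ be convex and continuously differentiable, and let $f=\max\{f_1,\dots,f_N\}$ with $f_i(x)=\langle v_i,x\rangle+g(x)$. Fix $\beta^0\in\mathbb{R}^p$, and let $f'(\beta^0;u)=\lim_{t\downarrow0}\bigl(f(\beta^0+tu)-f(\beta^0)\bigr)/t$. For $n\ge1$ let $\widehat u_{f,n}$ be a random vector which almost surely is a minimiser of $$u\mapsto \tfrac12u^TC_nu-u^TW_n+n^{1/2}\bigl[f(\beta^0+u/\sqrt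 n)-f(\beta^0)\bigr]$$ whenever this function has a minimiser (and is arbitrary otherwise), and let $\widehat u_f$ be the (almost surely unique) random minimiser of $$u\mapsto \tfrac12u^TCu-u^TW+f'(\beta^0;u),\qquad W\sim\mathcal N(0,\sigma^2C).$$ For $x\in\mathbb{R}^p$ let $I(x)=\{i: f_i(x)=f(x)\}\subset\{1,\dots,N\}$ be the pattern of $f$ at $x$, and let $\mathbf{patt}(x)\in\mathbb{Z}^p$, $\mathbf{patt}(x)_i=\mathrm{rank}(|x_i|)\,\mathrm{sgn}(x_i)$, be the SLOPE pattern, where $\mathrm{rank}(|x_i|)$ is the number of distinct nonzero values among $|x_1|,\dots,|x_p|$ that are at most $|x_i|$. \textbf{Theorem.} For every convex set $\mathcal K\subset\mathbb{R}^p$, $\mathbb P[\widehat u_{f,n}\in\mathcal K]\to\mathbb P[\widehat u_f\in\mathcal K]$ as $n\to\infty$ (with outer probabilities if $\mathcal K$ is not a Borel set). Moreover $I(\widehat u_{f,n})$ converges weakly to $I(\widehat u_f)$ (in the finite discrete space of subsets of $\{1,\dots,N\}$) and $\mathbf{patt}(\widehat u_{f,n})$ converges weakly to $\mathbf{patt}(\widehat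 u_f)$ (in the discrete space $\mathbb{Z}^p$). -/

import Mathlib

open MeasureTheory ProbabilityTheory Filter Topology

noncomputable section

namespace PenPattern

/-- The pointwise maximum `max {F 1, …, F N}` of finitely many functions on `ℝ^p`. -/
def maxFun {p N : ℕ} [NeZero N] (F : Fin N → EuclideanSpace ℝ (Fin p) → ℝ)
    (x : EuclideanSpace ℝ (Fin p)) : ℝ :=
  Finset.univ.sup' Finset.univ_nonempty fun i => F i x

/-- Patterns of a maximum of `N` functions, i.e. subsets of `{1, …, N}`,
regarded as a finite discrete space. -/
def MaxPattern (N : ℕ) : Type := Finset (Fin N)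

instance (N : ℕ) : TopologicalSpace (MaxPattern N) := ⊥

instance (N : ℕ) : DiscreteTopology (MaxPattern N) := ⟨rfl⟩

instance (N : ℕ) : MeasurableSpace (MaxPattern N) := ⊤

instance (N : ℕ) : DiscreteMeasurableSpace (MaxPattern N) := ⟨fun _ => trivial⟩

open Classical in
/-- The pattern `I(x) = {i : F i x = max_j F j x}` of `max {F 1, …, F N}` at `x`. -/
def activeSet {p N : ℕ} [NeZero N] (F : Fin N → EuclideanSpace ℝ (Fin p) → ℝ)
    (x : EuclideanSpace ℝ (Fin p)) : MaxPattern N :=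
  (Finset.univ.filter fun i => F i x = maxFun F x : Finset (Fin N))

/-- The functions `f_i(x) = ⟨v_i, x⟩ + g(x)`. -/
def piece {p N : ℕ} (v : Fin N → EuclideanSpace ℝ (Fin p)) (g : EuclideanSpace ℝ (Fin p) → ℝ)
    (i : Fin N) (x : EuclideanSpace ℝ (Fin p)) : ℝ :=
  inner ℝ (v i) x + g x

/-- The SLOPE pattern `patt(u)_i = rank(|u_i|) sgn(u_i)`, where the rank of `|u_i|` is its position
in the increasing list of the distinct nonzero values of `|u_1|, …, |u_p|`
(and `0` if `u_i = 0`). -/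
def slopePattern {p : ℕ} (u : EuclideanSpace ℝ (Fin p)) (i : Fin p) : ℤ :=
  (((Finset.univ.image fun j => |u j|).filter fun a => 0 < a ∧ a ≤ |u i|).card : ℤ) *
    (SignType.sign (u i) : ℤ)

/-- The one-sided directional derivative `f'(x; u) = lim_{t ↓ 0} (f (x + t u) - f x) / t`. -/
def dirDeriv {p : ℕ} (f : EuclideanSpace ℝ (Fin p) → ℝ) (x u : EuclideanSpace ℝ (Fin p)) : ℝ :=
  derivWithin (fun t : ℝ => f (x + t • u)) (Set.Ioi 0) 0

/-- The design matrix with rows `X_1, …, X_n`. -/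
def designMatrix {p : ℕ} (X : ℕ → EuclideanSpace ℝ (Fin p)) (n : ℕ) :
    Matrix (Fin n) (Fin p) ℝ :=
  Matrix.of fun i j => X i j

/-- `C_n = n⁻¹ XᵀX`. -/
def empCov {p : ℕ} (X : ℕ → EuclideanSpace ℝ (Fin p)) (n : ℕ) : Matrix (Fin p) (Fin p) ℝ :=
  (n : ℝ)⁻¹ • ((designMatrix X n).transpose * designMatrix X n)

/-- `W_n = n^{-1/2} Xᵀε`. -/
def score {p : ℕ} (X : ℕ → EuclideanSpace ℝ (Fin p)) (e : ℕ → ℝ) (n : ℕ) :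
    EuclideanSpace ℝ (Fin p) :=
  WithLp.toLp 2 ((√(n : ℝ))⁻¹ • (designMatrix X n).transpose.mulVec fun i : Fin n => e i)

/-- `uᵀ A u / 2 - uᵀ w`. -/
def quadLoss {p : ℕ} (A : Matrix (Fin p) (Fin p) ℝ) (w u : EuclideanSpace ℝ (Fin p)) : ℝ :=
  dotProduct u.ofLp (A.mulVec u.ofLp) / 2 - inner ℝ u w

/-- The rescaled objective
`uᵀ C_n u / 2 - uᵀ W_n + n^{1/2} (f (β₀ + u / √n) - f β₀)`. -/
def rescaledObjective {p : ℕ} (f : EuclideanSpace ℝ (Fin p) → ℝ) (β₀ : EuclideanSpace ℝ (Fin p))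
    (X : ℕ → EuclideanSpace ℝ (Fin p)) (e : ℕ → ℝ) (n : ℕ) (u : EuclideanSpace ℝ (Fin p)) : ℝ :=
  quadLoss (empCov X n) (score X e n) u + √(n : ℝ) * (f (β₀ + (√(n : ℝ))⁻¹ • u) - f β₀)

/-- The limiting objective `uᵀ C u / 2 - uᵀ w + f'(β₀; u)`. -/
def limitObjective {p : ℕ} (f : EuclideanSpace ℝ (Fin p) → ℝ) (β₀ : EuclideanSpace ℝ (Fin p))
    (C : Matrix (Fin p) (Fin p) ℝ) (w u : EuclideanSpace ℝ (Fin p)) : ℝ :=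
  quadLoss C w u + dirDeriv f β₀ u

end PenPattern

end

/-! Every minimiser is read through its first-order condition. Write `φ` for the maximum of the
forms `⟨v i, ·⟩` over the indices active at `β₀`. Up to the linear term `⟨∇g(β₀), ·⟩`, `φ` is the
directional derivative of the penalty, so the limit minimiser `u` solves `z ∈ C u + ∂φ(u)` with `z =
W - ∇g(β₀)`. Near `β₀` the active set of the penalty at `β₀ + u/√n` is the set of indices maximal
for `φ` at `u` (`eventually_argmaxOn_add`). Hence, on an event of large probability, the `n`-th
minimiser solves exactly the same inclusion, with datum `W_n - ∇g(β₀) + remainder`. The remainder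
tends to `0` in probability, by continuity of `∇g`, the law of large numbers for `C_n` and
boundedness of the minimisers (coercivity).

Since `C` is positive definite the inclusion has at most one solution, so the solution lies in `K`
exactly when the datum lies in the image of `K` under `C + ∂φ`. For convex `K` this image is a
finite union of convex sets, one for each value of the maximal index set. Its boundary is therefore
Lebesgue null, hence null for the nondegenerate Gaussian limit of the data. The central limit
theorem and the portmanteau theorem conclude.

The sets on which the active set or the SLOPE pattern is constant are convex, and both patterns take
countably many values, so weak convergence of the patterns follows from the statement on convex
sets. -/

noncomputable section

namespace PenPattern

/-! ### Maxima of linear forms and the set-valued map `M + ∂φ` -/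

section Argmax

open scoped Pointwise

variable {E ι : Type*} [NormedAddCommGroup E] [InnerProductSpace ℝ E]

open Classical in
/-- The indices in `I` at which the linear forms `⟨v i, ·⟩` attain their maximum over `I`
at the point `x`. -/
def argmaxOn (v : ι → E) (I : Finset ι) (x : E) : Finset ι :=
  I.filter fun i => ∀ j ∈ I, inner ℝ (v j) x ≤ inner ℝ (v i) x

/-- The vectors whose linear form is dominated by `max_{i ∈ J} ⟨v i, ·⟩`. -/
def dominatedSet (v : ι → E) (J : Finset ι) : Set E :=
  {s | ∀ h, ∃ i ∈ J, inner ℝ s h ≤ inner ℝ (v i) h}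

variable {v : ι → E} {I : Finset ι}

theorem mem_argmaxOn {x : E} {i : ι} :
    i ∈ argmaxOn v I x ↔ i ∈ I ∧ ∀ j ∈ I, inner ℝ (v j) x ≤ inner ℝ (v i) x := by
  simp [argmaxOn]

theorem argmaxOn_nonempty (hI : I.Nonempty) (x : E) : (argmaxOn v I x).Nonempty := by
  obtain ⟨i, hi, h⟩ := I.exists_max_image (fun i => inner ℝ (v i) x) hI
  exact ⟨i, mem_argmaxOn.2 ⟨hi, h⟩⟩

theorem argmaxOn_smul {t : ℝ} (ht : 0 < t) (x : E) : argmaxOn v I (t • x) = argmaxOn v I x := by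
  ext i
  simp [mem_argmaxOn, inner_smul_right, ht]

/-- If two points share a maximal index `k`, then any index maximal at a positive combination must
tie with `k` at both points; otherwise it would lose strictly against `k`. -/
theorem convex_setOf_argmaxOn_eq (v : ι → E) {I : Finset ι} (hI : I.Nonempty) (J : Finset ι) :
    Convex ℝ {x | argmaxOn v I x = J} := by
  rw [convex_iff_forall_pos]
  intro x hx y hy a b ha hb _
  simp only [Set.mem_ofPred_eq] at hx hy ⊢
  obtain ⟨k, hk⟩ := argmaxOn_nonempty (v := v) hI x
  have hk' : k ∈ argmaxOn v I y := by rwa [hy, ← hx]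
  ext i
  simp only [mem_argmaxOn, inner_add_right, inner_smul_right]
  constructor
  · rintro ⟨hi, h⟩
    rw [← hx]
    refine mem_argmaxOn.2 ⟨hi, fun j hj => ?_⟩
    by_contra! hlt
    have h1 := (mem_argmaxOn.1 hk).2 j hj
    have h2 := (mem_argmaxOn.1 hk').2 i hi
    have h3 := h k (mem_argmaxOn.1 hk).1
    nlinarith [mul_lt_mul_of_pos_left (hlt.trans_le h1) ha, mul_le_mul_of_nonneg_left h2 hb.le]
  · intro hi
    have h1 := mem_argmaxOn.1 (hx ▸ hi)
    have h2 := mem_argmaxOn.1 (hy ▸ hi)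
    exact ⟨h1.1, fun j hj => add_le_add (mul_le_mul_of_nonneg_left (h1.2 j hj) ha.le)
      (mul_le_mul_of_nonneg_left (h2.2 j hj) hb.le)⟩

/-- For finite `J` this is the convex hull of the `v i`, described by its support function. In that
form, of the two indices dominating `s` and `s'` in direction `h`, the one with the larger value
dominates the combination. -/
theorem convex_dominatedSet (v : ι → E) (J : Finset ι) : Convex ℝ (dominatedSet v J) := by
  intro s hs s' hs' a b ha hb hab h
  obtain ⟨i, hi, hsi⟩ := hs h
  obtain ⟨j, hj, hsj⟩ := hs' h
  simp only [inner_add_left, real_inner_smul_left]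
  rcases le_total (inner ℝ (v i) h) (inner ℝ (v j) h) with hij | hij
  · refine ⟨j, hj, ?_⟩
    calc a * inner ℝ s h + b * inner ℝ s' h
        ≤ a * inner ℝ (v j) h + b * inner ℝ (v j) h := by gcongr; exact hsi.trans hij
      _ = inner ℝ (v j) h := by rw [← add_mul, hab, one_mul]
  · refine ⟨i, hi, ?_⟩
    calc a * inner ℝ s h + b * inner ℝ s' h
        ≤ a * inner ℝ (v i) h + b * inner ℝ (v i) h := by gcongr; exact hsj.trans hij
      _ = inner ℝ (v i) h := by rw [← add_mul, hab, one_mul]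

/-- Near `x`, the active indices are those indices active at `x` which are active for the
increment. -/
theorem eventually_argmaxOn_add (v : ι → E) (I : Finset ι) (x : E) :
    ∀ᶠ u in 𝓝 (0 : E), argmaxOn v I (x + u) = argmaxOn v (argmaxOn v I x) u := by
  have key : ∀ᶠ u in 𝓝 (0 : E), ∀ i ∈ I, ∀ j ∈ I, inner ℝ (v i) x < inner ℝ (v j) x →
      inner ℝ (v i) (x + u) < inner ℝ (v j) (x + u) := by
    simp only [Finset.eventually_all, eventually_imp_distrib_left]
    intro i _ j _ hij
    refine ContinuousAt.eventually_lt (by fun_prop) (by fun_prop) ?_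
    simpa using hij
  filter_upwards [key] with u hu
  ext i
  constructor
  · intro hi
    obtain ⟨hiI, hmax⟩ := mem_argmaxOn.1 hi
    have hi0 : i ∈ argmaxOn v I x := by
      refine mem_argmaxOn.2 ⟨hiI, fun j hj => ?_⟩
      by_contra! hlt
      exact absurd (hmax j hj) (not_le.2 (hu i hiI j hj hlt))
    refine mem_argmaxOn.2 ⟨hi0, fun j hj => ?_⟩
    have h1 := hmax j (mem_argmaxOn.1 hj).1
    have h2 := (mem_argmaxOn.1 hj).2 i hiI
    simp only [inner_add_right] at h1
    linarith
  · intro hi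
    obtain ⟨hi0, hmax⟩ := mem_argmaxOn.1 hi
    obtain ⟨hiI, hmax0⟩ := mem_argmaxOn.1 hi0
    refine mem_argmaxOn.2 ⟨hiI, fun j hj => ?_⟩
    rcases (hmax0 j hj).lt_or_eq with hlt | heq
    · exact (hu j hj i hiI hlt).le
    · have hj0 : j ∈ argmaxOn v I x :=
        mem_argmaxOn.2 ⟨hj, fun k hk => (hmax0 k hk).trans heq.ge⟩
      simp only [inner_add_right]
      linarith [hmax j hj0]

theorem eventually_mem_argmaxOn_add_smul {x h : E} {i : ι}
    (hi : i ∈ argmaxOn v (argmaxOn v I x) h) :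
    ∀ᶠ t in 𝓝[>] (0 : ℝ), i ∈ argmaxOn v I (x + t • h) := by
  have hlim : Tendsto (fun t : ℝ => t • h) (𝓝[>] 0) (𝓝 0) := by
    have : Tendsto (fun t : ℝ => t • h) (𝓝 0) (𝓝 ((0 : ℝ) • h)) :=
      (continuous_id.smul continuous_const).tendsto 0
    rw [zero_smul] at this
    exact this.mono_left nhdsWithin_le_nhds
  filter_upwards [hlim.eventually (eventually_argmaxOn_add v I x), self_mem_nhdsWithin]
    with t ht htpos
  rwa [ht, argmaxOn_smul htpos]

/-- Monotonicity of the subdifferential of `max_{i ∈ I} ⟨v i, ·⟩`, with a strictly monotone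
perturbation: the inclusion `z ∈ M u + ∂φ(u)` has at most one solution. -/
theorem eq_of_sub_mem_dominatedSet {M : E →L[ℝ] E} (hM : ∀ u, u ≠ 0 → 0 < inner ℝ (M u) u)
    {z u w : E} (hu : z - M u ∈ dominatedSet v (argmaxOn v I u))
    (hw : z - M w ∈ dominatedSet v (argmaxOn v I w)) : u = w := by
  by_contra hne
  -- Testing the two inclusions in the opposite directions `w - u` and `u - w` and adding gives `⟨M
  -- (w - u), w - u⟩ ≤ ⟨v i - v j, w - u⟩`, which is nonpositive because `i` is maximal at `u` and
  -- `j` at `w`.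
  have hpos := hM (w - u) (sub_ne_zero.2 (Ne.symm hne))
  obtain ⟨i, hi, h1⟩ := hu (w - u)
  obtain ⟨j, hj, h2⟩ := hw (u - w)
  have h3 := (mem_argmaxOn.1 hj).2 i (mem_argmaxOn.1 hi).1
  have h4 := (mem_argmaxOn.1 hi).2 j (mem_argmaxOn.1 hj).1
  simp only [inner_sub_left, inner_sub_right, map_sub] at *
  linarith

/-- The image of `K` under the set-valued map `u ↦ M u + ∂φ(u)`, `φ = max_{i ∈ I} ⟨v i, ·⟩`. -/
def shiftedImage (v : ι → E) (I : Finset ι) (M : E →L[ℝ] E) (K : Set E) : Set E :=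
  {z | ∃ u ∈ K, z - M u ∈ dominatedSet v (argmaxOn v I u)}

/-- Where the maximal index set is constantly `J`, so is the subdifferential; each such cell
contributes a Minkowski sum, which is convex when `K` is. -/
theorem shiftedImage_eq_iUnion (v : ι → E) (I : Finset ι) (M : E →L[ℝ] E) (K : Set E) :
    shiftedImage v I M K =
      ⋃ J ∈ I.powerset, (M '' (K ∩ {u | argmaxOn v I u = J}) + dominatedSet v J) := by
  ext z
  simp only [shiftedImage, Set.mem_ofPred_eq, Set.mem_iUnion, Set.mem_add, Set.mem_image,
    Set.mem_inter_iff, exists_prop]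
  constructor
  · rintro ⟨u, hu, hz⟩
    refine ⟨argmaxOn v I u, ?_, M u, ⟨u, ⟨hu, rfl⟩, rfl⟩, z - M u, hz, by abel⟩
    exact Finset.mem_powerset.2 fun i hi => (mem_argmaxOn.1 hi).1
  · rintro ⟨J, _, _, ⟨u, ⟨hu, rfl⟩, rfl⟩, s, hs, rfl⟩
    exact ⟨u, hu, by simpa using hs⟩

theorem mem_shiftedImage_iff {M : E →L[ℝ] E} (hM : ∀ u, u ≠ 0 → 0 < inner ℝ (M u) u)
    {K : Set E} {z u : E} (hu : z - M u ∈ dominatedSet v (argmaxOn v I u)) :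
    z ∈ shiftedImage v I M K ↔ u ∈ K := by
  refine ⟨?_, fun h => ⟨u, h, hu⟩⟩
  rintro ⟨w, hw, hz⟩
  rwa [eq_of_sub_mem_dominatedSet hM hu hz]

/-- A convex set in finite dimension has null frontier, and the frontier of a finite union lies in
the union of the frontiers. Measurability of `K` plays no role. -/
theorem addHaar_frontier_shiftedImage [FiniteDimensional ℝ E] [MeasurableSpace E] [BorelSpace E]
    (μ : Measure E) [μ.IsAddHaarMeasure] (v : ι → E) (hI : I.Nonempty) (M : E →L[ℝ] E)
    {K : Set E} (hK : Convex ℝ K) : μ (frontier (shiftedImage v I M K)) = 0 := by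
  rw [shiftedImage_eq_iUnion]
  have hconv : ∀ J, Convex ℝ (M '' (K ∩ {u | argmaxOn v I u = J}) + dominatedSet v J) := fun J =>
    ((hK.inter (convex_setOf_argmaxOn_eq v hI J)).linear_image M.toLinearMap).add
      (convex_dominatedSet v J)
  have : ∀ s : Finset (Finset ι), μ (frontier (⋃ J ∈ s,
      (M '' (K ∩ {u | argmaxOn v I u = J}) + dominatedSet v J))) = 0 := by
    classical
    intro s
    induction s using Finset.induction_on with
    | empty => simp
    | insert J s _ ih =>
      rw [Finset.set_biUnion_insert]
      refine measure_mono_null (frontier_union_subset _ _) (measure_union_null ?_ ?_)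
      · exact measure_mono_null Set.inter_subset_left ((hconv J).addHaar_frontier μ)
      · exact measure_mono_null Set.inter_subset_right ih
  exact this _

/-- First-order condition at a minimiser of a quadratic function plus a function with one-sided
derivatives. -/
theorem inner_sub_le_of_isMinOn {M : E →L[ℝ] E} (hM : ∀ x y, inner ℝ (M x) y = inner ℝ x (M y))
    {w u h : E} {ψ : E → ℝ} {d : ℝ}
    (hmin : IsMinOn (fun u => inner ℝ u (M u) / 2 - inner ℝ u w + ψ u) Set.univ u)
    (hd : HasDerivWithinAt (fun t : ℝ => ψ (u + t • h)) d (Set.Ioi 0) 0) :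
    inner ℝ (w - M u) h ≤ d := by
  -- Along the ray the quadratic part is exactly this polynomial in `t`; symmetry of `M` merges the
  -- cross terms.
  have hq : HasDerivAt (fun t : ℝ => (inner ℝ u (M u) / 2 - inner ℝ u w)
      + t * inner ℝ (M u - w) h + t ^ 2 * (inner ℝ h (M h) / 2)) (inner ℝ (M u - w) h) 0 := by
    have h1 := ((hasDerivAt_id (0 : ℝ)).mul_const (inner ℝ (M u - w) h)).const_add
      (inner ℝ u (M u) / 2 - inner ℝ u w)
    have h2 := ((hasDerivAt_id (0 : ℝ)).pow 2).mul_const (inner ℝ h (M h) / 2)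
    simpa using h1.fun_add h2
  have hsum := hq.hasDerivWithinAt (s := Set.Ioi 0) |>.add hd
  have hslope := hasDerivWithinAt_iff_tendsto_slope.1 hsum
  rw [Set.sdiff_singleton_eq_self (by simp)] at hslope
  have hnonneg : 0 ≤ inner ℝ (M u - w) h + d := by
    refine ge_of_tendsto hslope ?_
    filter_upwards [self_mem_nhdsWithin] with t ht
    have ht : (0 : ℝ) < t := ht
    rw [slope_def_field]
    refine div_nonneg ?_ (by linarith)
    have := hmin (Set.mem_univ (u + t • h))
    simp only [Set.mem_ofPred_eq] at this
    have hexp : inner ℝ (u + t • h) (M (u + t • h)) / 2 - inner ℝ (u + t • h) w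
        = (inner ℝ u (M u) / 2 - inner ℝ u w)
          + t * inner ℝ (M u - w) h + t ^ 2 * (inner ℝ h (M h) / 2) := by
      simp only [map_add, map_smul, inner_add_left, inner_add_right, real_inner_smul_left,
        real_inner_smul_right, inner_sub_left]
      rw [← hM u h, real_inner_comm w h, real_inner_comm (M u) h]
      ring
    rw [hexp] at this
    simpa using this
  have : inner ℝ (w - M u) h = - inner ℝ (M u - w) h := by rw [← inner_neg_left, neg_sub]
  linarith

end Argmax

/-! ### One-sided derivatives of the penalty and first-order conditions -/

section Penalty

variable {p N : ℕ} [NeZero N] (v : Fin N → EuclideanSpace ℝ (Fin p))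
  (g : EuclideanSpace ℝ (Fin p) → ℝ)

theorem mem_argmaxOn_univ_iff_maxFun {x : EuclideanSpace ℝ (Fin p)} {i : Fin N} :
    i ∈ argmaxOn v Finset.univ x ↔ piece v g i x = maxFun (piece v g) x := by
  simp only [mem_argmaxOn, Finset.mem_univ, true_and, forall_const, maxFun]
  constructor
  · intro h
    refine le_antisymm (Finset.le_sup' (fun i => piece v g i x) (Finset.mem_univ i)) ?_
    exact Finset.sup'_le _ _ fun j _ => add_le_add_left (h j) _
  · intro h j
    have := Finset.le_sup' (fun i => piece v g i x) (Finset.mem_univ j)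
    rw [← h] at this
    simpa [piece] using this

theorem activeSet_eq_argmaxOn (x : EuclideanSpace ℝ (Fin p)) :
    activeSet (piece v g) x = argmaxOn v Finset.univ x := by
  refine Finset.ext fun i => ?_
  rw [mem_argmaxOn_univ_iff_maxFun v g]
  exact (Finset.mem_filter).trans (by simp)

variable {v g}

theorem maxFun_piece_eq {x : EuclideanSpace ℝ (Fin p)} {i : Fin N}
    (hi : i ∈ argmaxOn v Finset.univ x) : maxFun (piece v g) x = inner ℝ (v i) x + g x :=
  ((mem_argmaxOn_univ_iff_maxFun v g).1 hi).symm

/-- An index active at `x` and then maximal in direction `h` stays active at `x + t • h` for small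
`t > 0`, so along the ray the maximum coincides with one differentiable piece. -/
theorem hasDerivWithinAt_maxFun_piece {x h : EuclideanSpace ℝ (Fin p)}
    (hg : DifferentiableAt ℝ g x) {i : Fin N}
    (hi : i ∈ argmaxOn v (argmaxOn v Finset.univ x) h) :
    HasDerivWithinAt (fun t : ℝ => maxFun (piece v g) (x + t • h))
      (inner ℝ (v i) h + inner ℝ (gradient g x) h) (Set.Ioi 0) 0 := by
  have hline : HasDerivAt (fun t : ℝ => x + t • h) h 0 := by
    simpa using ((hasDerivAt_id (0 : ℝ)).smul_const h).const_add x
  have h1 : HasDerivAt (fun t : ℝ => inner ℝ (v i) (x + t • h)) (inner ℝ (v i) h) 0 :=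
    (innerSL ℝ (v i)).hasFDerivAt.comp_hasDerivAt (0 : ℝ) hline
  have h2 : HasDerivAt (fun t : ℝ => g (x + t • h)) (inner ℝ (gradient g x) h) 0 := by
    have hg' : HasFDerivAt g (InnerProductSpace.toDual ℝ _ (gradient g x)) (x + (0 : ℝ) • h) := by
      simpa using hg.hasGradientAt.hasFDerivAt
    simpa [Function.comp_def] using hg'.comp_hasDerivAt (0 : ℝ) hline
  refine (h1.add h2).hasDerivWithinAt.congr_of_eventuallyEq ?_ ?_
  · filter_upwards [eventually_mem_argmaxOn_add_smul hi] with t ht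
    exact maxFun_piece_eq ht
  · simpa using maxFun_piece_eq (g := g) (mem_argmaxOn.1 hi).1

theorem dirDeriv_maxFun_piece {x h : EuclideanSpace ℝ (Fin p)}
    (hg : DifferentiableAt ℝ g x) {i : Fin N}
    (hi : i ∈ argmaxOn v (argmaxOn v Finset.univ x) h) :
    dirDeriv (maxFun (piece v g)) x h = inner ℝ (v i) h + inner ℝ (gradient g x) h :=
  (hasDerivWithinAt_maxFun_piece hg hi).derivWithin (uniqueDiffWithinAt_Ioi 0)

/-- The directional derivative at `x` is again a maximum of linear forms, over the indices active at
`x`, plus a linear term; the ray argument applies once more, one level down. -/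
theorem hasDerivWithinAt_dirDeriv_maxFun_piece {x u h : EuclideanSpace ℝ (Fin p)}
    (hg : DifferentiableAt ℝ g x) {i : Fin N}
    (hi : i ∈ argmaxOn v (argmaxOn v (argmaxOn v Finset.univ x) u) h) :
    HasDerivWithinAt (fun t : ℝ => dirDeriv (maxFun (piece v g)) x (u + t • h))
      (inner ℝ (v i) h + inner ℝ (gradient g x) h) (Set.Ioi 0) 0 := by
  have hline : HasDerivAt (fun t : ℝ => u + t • h) h 0 := by
    simpa using ((hasDerivAt_id (0 : ℝ)).smul_const h).const_add u
  have h1 : HasDerivAt (fun t : ℝ => inner ℝ (v i) (u + t • h)) (inner ℝ (v i) h) 0 :=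
    (innerSL ℝ (v i)).hasFDerivAt.comp_hasDerivAt (0 : ℝ) hline
  have h2 : HasDerivAt (fun t : ℝ => inner ℝ (gradient g x) (u + t • h))
      (inner ℝ (gradient g x) h) 0 :=
    (innerSL ℝ (gradient g x)).hasFDerivAt.comp_hasDerivAt (0 : ℝ) hline
  refine (h1.add h2).hasDerivWithinAt.congr_of_eventuallyEq ?_ ?_
  · filter_upwards [eventually_mem_argmaxOn_add_smul hi] with t ht
    exact dirDeriv_maxFun_piece hg ht
  · simpa using dirDeriv_maxFun_piece hg (mem_argmaxOn.1 hi).1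

theorem continuous_maxFun_piece (hg : Continuous g) : Continuous (maxFun (piece v g)) := by
  unfold maxFun piece
  refine Continuous.finset_sup'_apply _ fun i _ => ?_
  fun_prop

theorem quadLoss_eq_inner (A : Matrix (Fin p) (Fin p) ℝ) (w u : EuclideanSpace ℝ (Fin p)) :
    quadLoss A w u = inner ℝ u (Matrix.toEuclideanCLM (𝕜 := ℝ) A u) / 2 - inner ℝ u w := by
  rw [quadLoss, Matrix.inner_toEuclideanCLM]

theorem inner_toEuclideanCLM_comm {A : Matrix (Fin p) (Fin p) ℝ} (hA : A.IsHermitian)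
    (x y : EuclideanSpace ℝ (Fin p)) :
    inner ℝ (Matrix.toEuclideanCLM (𝕜 := ℝ) A x) y
      = inner ℝ x (Matrix.toEuclideanCLM (𝕜 := ℝ) A y) := by
  have h : IsSelfAdjoint (Matrix.toEuclideanCLM (𝕜 := ℝ) A) :=
    IsSelfAdjoint.map (show IsSelfAdjoint A from hA) _
  rw [← ContinuousLinearMap.adjoint_inner_right, h.adjoint_eq]

/-- First-order condition for the limiting objective. -/
theorem sub_mem_dominatedSet_of_isMinOn_limitObjective {C : Matrix (Fin p) (Fin p) ℝ}
    (hC : C.IsHermitian) {β₀ w u : EuclideanSpace ℝ (Fin p)} (hg : DifferentiableAt ℝ g β₀)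
    (hmin : IsMinOn (limitObjective (maxFun (piece v g)) β₀ C w) Set.univ u) :
    w - gradient g β₀ - Matrix.toEuclideanCLM (𝕜 := ℝ) C u ∈
      dominatedSet v (argmaxOn v (argmaxOn v Finset.univ β₀) u) := by
  intro h
  obtain ⟨i, hi⟩ := argmaxOn_nonempty (v := v) (argmaxOn_nonempty (v := v) (argmaxOn_nonempty
    (v := v) Finset.univ_nonempty β₀) u) h
  refine ⟨i, (mem_argmaxOn.1 hi).1, ?_⟩
  have := inner_sub_le_of_isMinOn (inner_toEuclideanCLM_comm hC) (w := w)
    (ψ := dirDeriv (maxFun (piece v g)) β₀)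
    (by simp only [← quadLoss_eq_inner]; exact hmin)
    (hasDerivWithinAt_dirDeriv_maxFun_piece hg hi)
  rw [sub_right_comm, inner_sub_left]
  linarith

/-- First-order condition for the rescaled objective. -/
theorem sub_mem_dominatedSet_of_isMinOn_rescaledObjective
    {β₀ u : EuclideanSpace ℝ (Fin p)} {X : ℕ → EuclideanSpace ℝ (Fin p)} {e : ℕ → ℝ} {n : ℕ}
    (hn : 0 < n) (hg : Differentiable ℝ g)
    (hmin : IsMinOn (rescaledObjective (maxFun (piece v g)) β₀ X e n) Set.univ u) :
    score X e n - gradient g (β₀ + (√(n : ℝ))⁻¹ • u)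
        - Matrix.toEuclideanCLM (𝕜 := ℝ) (empCov X n) u ∈
      dominatedSet v (argmaxOn v Finset.univ (β₀ + (√(n : ℝ))⁻¹ • u)) := by
  intro h
  have hsq : 0 < √(n : ℝ) := Real.sqrt_pos.2 (Nat.cast_pos.2 hn)
  have hA : (empCov X n).IsHermitian := by
    ext i j
    simp [empCov, Matrix.mul_apply, mul_comm]
  set x := β₀ + (√(n : ℝ))⁻¹ • u with hx
  -- Moving `u` by `t • h` moves `x` by `t • (√n)⁻¹ • h`; this factor cancels the `√n` in front of
  -- the penalty.
  obtain ⟨i, hi⟩ := argmaxOn_nonempty (v := v) (argmaxOn_nonempty (v := v)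
    Finset.univ_nonempty x) ((√(n : ℝ))⁻¹ • h)
  refine ⟨i, (mem_argmaxOn.1 hi).1, ?_⟩
  have hd := ((hasDerivWithinAt_maxFun_piece (hg x) hi).sub_const
    (maxFun (piece v g) β₀)).const_mul (√(n : ℝ))
  have := inner_sub_le_of_isMinOn (inner_toEuclideanCLM_comm hA) (w := score X e n) (u := u)
    (h := h) (ψ := fun u => √(n : ℝ) * (maxFun (piece v g) (β₀ + (√(n : ℝ))⁻¹ • u)
      - maxFun (piece v g) β₀))
    (by simp only [← quadLoss_eq_inner]; exact hmin)
    (hd.congr (fun t _ => by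
      simp only [hx, smul_add, add_assoc, smul_comm t]) (by simp [x]))
  rw [inner_smul_right, inner_smul_right, ← mul_add, mul_inv_cancel_left₀ hsq.ne'] at this
  rw [sub_right_comm, inner_sub_left]
  linarith

end Penalty

/-! ### Coercivity, existence and boundedness of minimisers -/

section Coercivity

/-- Gradient inequality for a differentiable convex function. -/
theorem _root_.ConvexOn.add_inner_gradient_le {E : Type*} [NormedAddCommGroup E]
    [InnerProductSpace ℝ E] [CompleteSpace E] {g : E → ℝ} (hg : ConvexOn ℝ Set.univ g) {x : E}
    (hx : DifferentiableAt ℝ g x) (h : E) : g x + inner ℝ (gradient g x) h ≤ g (x + h) := by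
  have hline : HasDerivAt (fun t : ℝ => x + t • h) h 0 := by
    simpa using ((hasDerivAt_id (0 : ℝ)).smul_const h).const_add x
  have hd : HasDerivAt (fun t : ℝ => g (x + t • h)) (inner ℝ (gradient g x) h) 0 := by
    have hg' : HasFDerivAt g (InnerProductSpace.toDual ℝ _ (gradient g x)) (x + (0 : ℝ) • h) := by
      simpa using hx.hasGradientAt.hasFDerivAt
    simpa [Function.comp_def] using hg'.comp_hasDerivAt (0 : ℝ) hline
  have hc : ConvexOn ℝ Set.univ (fun t : ℝ => g (x + t • h)) := by
    refine ⟨convex_univ, fun s _ t _ a b ha hb hab => ?_⟩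
    have := hg.2 (Set.mem_univ (x + s • h)) (Set.mem_univ (x + t • h)) ha hb hab
    convert this using 2
    have hx' : x = (a + b) • x := by rw [hab, one_smul]
    simp only [smul_eq_mul]
    nth_rewrite 1 [hx']
    module
  have := hc.le_slope_of_hasDerivAt (Set.mem_univ 0) (Set.mem_univ 1) zero_lt_one hd
  simp [slope_def_field] at this
  simpa using (le_sub_iff_add_le'.1 this)

theorem exists_pos_mul_norm_sq_le_inner {p : ℕ} {C : Matrix (Fin p) (Fin p) ℝ} (hC : C.PosDef) :
    ∃ c > 0, ∀ u : EuclideanSpace ℝ (Fin p),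
      c * ‖u‖ ^ 2 ≤ inner ℝ u (Matrix.toEuclideanCLM (𝕜 := ℝ) C u) := by
  have hpos : ∀ u : EuclideanSpace ℝ (Fin p), u ≠ 0 →
      0 < inner ℝ u (Matrix.toEuclideanCLM (𝕜 := ℝ) C u) := fun u hu => by
    rw [Matrix.inner_toEuclideanCLM]
    have hu' : u.ofLp ≠ 0 := fun h => hu (by ext i; simp [h])
    simpa using hC.dotProduct_mulVec_pos hu'
  -- The unit sphere is empty exactly when the space is trivial, that is when `p = 0`.
  rcases (Metric.sphere (0 : EuclideanSpace ℝ (Fin p)) 1).eq_empty_or_nonempty with he | hne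
  · refine ⟨1, one_pos, fun u => ?_⟩
    have : u = 0 := by
      by_contra hu
      have : ‖u‖⁻¹ • u ∈ Metric.sphere (0 : EuclideanSpace ℝ (Fin p)) 1 := by
        simp [norm_smul, hu]
      simp [he] at this
    simp [this]
  · obtain ⟨w, hw, hmin⟩ := (isCompact_sphere (0 : EuclideanSpace ℝ (Fin p)) 1).exists_isMinOn hne
      (f := fun u => inner ℝ u (Matrix.toEuclideanCLM (𝕜 := ℝ) C u)) (by fun_prop)
    refine ⟨_, hpos w (by rintro rfl; simp at hw), fun u => ?_⟩
    rcases eq_or_ne u 0 with rfl | hu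
    · simp
    have hu' : 0 < ‖u‖ := norm_pos_iff.2 hu
    have := hmin (show ‖u‖⁻¹ • u ∈ Metric.sphere (0 : EuclideanSpace ℝ (Fin p)) 1 by
      simp [norm_smul, hu])
    simp only [Set.mem_ofPred_eq, map_smul, inner_smul_left, inner_smul_right] at this
    rw [← le_div_iff₀ (by positivity)]
    refine this.trans_eq ?_
    simp
    field_simp

variable {p N : ℕ} [NeZero N] {v : Fin N → EuclideanSpace ℝ (Fin p)}
  {g : EuclideanSpace ℝ (Fin p) → ℝ}

theorem inner_add_gradient_le_maxFun_piece_sub (hg : ConvexOn ℝ Set.univ g)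
    {x : EuclideanSpace ℝ (Fin p)} (hx : DifferentiableAt ℝ g x) {i : Fin N}
    (hi : i ∈ argmaxOn v Finset.univ x) (h : EuclideanSpace ℝ (Fin p)) :
    inner ℝ (v i + gradient g x) h ≤ maxFun (piece v g) (x + h) - maxFun (piece v g) x := by
  have h1 := Finset.le_sup' (fun j => piece v g j (x + h)) (Finset.mem_univ i)
  have h2 := hg.add_inner_gradient_le hx h
  rw [maxFun_piece_eq hi]
  have h3 : piece v g i (x + h) ≤ maxFun (piece v g) (x + h) := h1
  simp only [piece, inner_add_left, inner_add_right] at h3 ⊢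
  linarith

theorem rescaledObjective_zero (f : EuclideanSpace ℝ (Fin p) → ℝ) (β₀ : EuclideanSpace ℝ (Fin p))
    (X : ℕ → EuclideanSpace ℝ (Fin p)) (e : ℕ → ℝ) (n : ℕ) :
    rescaledObjective f β₀ X e n 0 = 0 := by
  simp [rescaledObjective, quadLoss]

variable {β₀ : EuclideanSpace ℝ (Fin p)} {X : ℕ → EuclideanSpace ℝ (Fin p)} {e : ℕ → ℝ} {n : ℕ}
  {c : ℝ}

/-- The subgradient `v i + ∇g(β₀)` bounds the penalty increment below by a linear form, and
rescaling by `√n` leaves that form unchanged. The bound depends on `n` only through the score once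
`c` is fixed. -/
theorem le_rescaledObjective (hn : 0 < n) (hg : ConvexOn ℝ Set.univ g)
    (hx : DifferentiableAt ℝ g β₀) {i : Fin N} (hi : i ∈ argmaxOn v Finset.univ β₀)
    (hM : ∀ u : EuclideanSpace ℝ (Fin p),
      c * ‖u‖ ^ 2 ≤ inner ℝ u (Matrix.toEuclideanCLM (𝕜 := ℝ) (empCov X n) u))
    (u : EuclideanSpace ℝ (Fin p)) :
    ‖u‖ * (c / 2 * ‖u‖ - (‖score X e n‖ + ‖v i + gradient g β₀‖)) ≤
      rescaledObjective (maxFun (piece v g)) β₀ X e n u := by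
  have hsq : 0 < √(n : ℝ) := Real.sqrt_pos.2 (Nat.cast_pos.2 hn)
  have h1 := mul_le_mul_of_nonneg_left
    (inner_add_gradient_le_maxFun_piece_sub hg hx hi ((√(n : ℝ))⁻¹ • u)) hsq.le
  rw [inner_smul_right, mul_inv_cancel_left₀ hsq.ne'] at h1
  have h2 := neg_le_of_abs_le (abs_real_inner_le_norm (v i + gradient g β₀) u)
  have h3 := real_inner_le_norm u (score X e n)
  have h4 := hM u
  rw [rescaledObjective, quadLoss_eq_inner]
  nlinarith

theorem exists_isMinOn_rescaledObjective (hn : 0 < n) (hg : ConvexOn ℝ Set.univ g)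
    (hd : Differentiable ℝ g) (hc : 0 < c)
    (hM : ∀ u : EuclideanSpace ℝ (Fin p),
      c * ‖u‖ ^ 2 ≤ inner ℝ u (Matrix.toEuclideanCLM (𝕜 := ℝ) (empCov X n) u)) :
    ∃ u, IsMinOn (rescaledObjective (maxFun (piece v g)) β₀ X e n) Set.univ u := by
  obtain ⟨i, hi⟩ := argmaxOn_nonempty (v := v) Finset.univ_nonempty β₀
  have hcont : Continuous (rescaledObjective (maxFun (piece v g)) β₀ X e n) := by
    have hF := continuous_maxFun_piece (v := v) hd.continuous
    unfold rescaledObjective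
    simp only [quadLoss_eq_inner]
    fun_prop
  have hlim : Tendsto (rescaledObjective (maxFun (piece v g)) β₀ X e n) (cocompact _) atTop := by
    refine tendsto_atTop_mono (le_rescaledObjective hn hg (hd β₀) hi hM) ?_
    have hnorm := tendsto_norm_cocompact_atTop (E := EuclideanSpace ℝ (Fin p))
    refine hnorm.atTop_mul_atTop₀ ?_
    exact tendsto_atTop_add_const_right _ _ (hnorm.const_mul_atTop (half_pos hc))
  obtain ⟨u, hu⟩ := hcont.exists_forall_le hlim
  exact ⟨u, fun w _ => hu w⟩

/-- The objective vanishes at `0`, so its minimum is nonpositive, and the quadratic lower bound then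
confines the minimiser. -/
theorem norm_le_of_isMinOn_rescaledObjective (hn : 0 < n) (hg : ConvexOn ℝ Set.univ g)
    (hd : Differentiable ℝ g) (hc : 0 < c)
    (hM : ∀ u : EuclideanSpace ℝ (Fin p),
      c * ‖u‖ ^ 2 ≤ inner ℝ u (Matrix.toEuclideanCLM (𝕜 := ℝ) (empCov X n) u))
    {i : Fin N} (hi : i ∈ argmaxOn v Finset.univ β₀) {u : EuclideanSpace ℝ (Fin p)}
    (hu : IsMinOn (rescaledObjective (maxFun (piece v g)) β₀ X e n) Set.univ u) :
    ‖u‖ ≤ 2 / c * (‖score X e n‖ + ‖v i + gradient g β₀‖) := by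
  have h1 := le_rescaledObjective (e := e) hn hg (hd β₀) hi hM u
  have h2 : rescaledObjective (maxFun (piece v g)) β₀ X e n u ≤ 0 := by
    rw [← rescaledObjective_zero (maxFun (piece v g)) β₀ X e n]
    exact hu (Set.mem_univ 0)
  rcases (norm_nonneg u).eq_or_lt with h0 | h0
  · rw [← h0]; positivity
  · have h3 : c / 2 * ‖u‖ - (‖score X e n‖ + ‖v i + gradient g β₀‖) ≤ 0 :=
      nonpos_of_mul_nonpos_right (h1.trans h2) h0
    rw [div_mul_eq_mul_div, le_div_iff₀ hc]
    linarith

theorem half_mul_norm_sq_le_inner {E : Type*} [NormedAddCommGroup E] [InnerProductSpace ℝ E]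
    {A B : E →L[ℝ] E} (hA : ∀ u, c * ‖u‖ ^ 2 ≤ inner ℝ u (A u))
    (hAB : ‖A - B‖ ≤ c / 2) (u : E) : c / 2 * ‖u‖ ^ 2 ≤ inner ℝ u (B u) := by
  have h1 : inner ℝ u ((A - B) u) ≤ c / 2 * ‖u‖ ^ 2 :=
    calc inner ℝ u ((A - B) u) ≤ ‖u‖ * ‖(A - B) u‖ := real_inner_le_norm _ _
      _ ≤ ‖u‖ * (c / 2 * ‖u‖) := by gcongr; exact (A - B).le_of_opNorm_le hAB u
      _ = c / 2 * ‖u‖ ^ 2 := by ring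
  have h2 := hA u
  simp only [sub_apply, inner_sub_right] at h1
  linarith

end Coercivity

/-! ### Convexity and measurability of the SLOPE pattern classes -/

section SlopePattern

variable {p : ℕ}

/-- The number of distinct nonzero values among the `|u j|` that are at most `|u i|`. -/
def slopeRank (u : EuclideanSpace ℝ (Fin p)) (i : Fin p) : ℕ :=
  ((Finset.univ.image fun j => |u j|).filter fun a => 0 < a ∧ a ≤ |u i|).card

theorem slopePattern_eq (u : EuclideanSpace ℝ (Fin p)) (i : Fin p) :
    slopePattern u i = slopeRank u i * (SignType.sign (u i) : ℤ) := rfl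

theorem slopeRank_lt_slopeRank {u : EuclideanSpace ℝ (Fin p)} {i j : Fin p} (h : |u i| < |u j|) :
    slopeRank u i < slopeRank u j := by
  refine Finset.card_lt_card (Finset.ssubset_iff_of_subset ?_ |>.2 ⟨|u j|, ?_, ?_⟩)
  · exact Finset.monotone_filter_right _ fun a _ ha => ⟨ha.1, ha.2.trans h.le⟩
  · simpa using (abs_nonneg (u i)).trans_lt h
  · simp [h]

theorem slopeRank_le_slopeRank_iff {u : EuclideanSpace ℝ (Fin p)} {i j : Fin p} :
    slopeRank u i ≤ slopeRank u j ↔ |u i| ≤ |u j| := by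
  constructor
  · intro h
    by_contra! hlt
    exact absurd h (not_le.2 (slopeRank_lt_slopeRank hlt))
  · intro h
    exact Finset.card_le_card (Finset.monotone_filter_right _ fun a _ ha => ⟨ha.1, ha.2.trans h⟩)

theorem slopeRank_pos {u : EuclideanSpace ℝ (Fin p)} {i : Fin p} (h : u i ≠ 0) :
    0 < slopeRank u i :=
  Finset.card_pos.2 ⟨|u i|, by simp [h]⟩

theorem sign_slopePattern (u : EuclideanSpace ℝ (Fin p)) (i : Fin p) :
    SignType.sign (slopePattern u i) = SignType.sign (u i) := by
  rw [slopePattern_eq]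
  rcases lt_trichotomy (u i) 0 with h | h | h
  · have := slopeRank_pos h.ne
    simp [h, sign_neg, this]
  · simp [h]
  · have := slopeRank_pos h.ne'
    simp [h, sign_pos, this]

theorem natAbs_slopePattern (u : EuclideanSpace ℝ (Fin p)) (i : Fin p) :
    (slopePattern u i).natAbs = slopeRank u i := by
  rw [slopePattern_eq]
  rcases lt_trichotomy (u i) 0 with h | h | h
  · simp [h, sign_neg]
  · have : slopeRank u i = 0 := by
      refine Finset.card_eq_zero.2 (Finset.filter_eq_empty_iff.2 fun a _ => ?_)
      simp only [h, abs_zero, not_and, not_le]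
      exact id
    simp [h, this]
  · simp [h, sign_pos]

/-- The signs of the coordinates of a vector and the order of their absolute values. -/
def slopeOrder (u : EuclideanSpace ℝ (Fin p)) : (Fin p → SignType) × (Fin p → Fin p → Prop) :=
  (fun i => SignType.sign (u i), fun i j => |u i| ≤ |u j|)

/-- Equal orderings make `|w j| ↦ |u j|` a well-defined map of values, and it sends the values
counted for `w` onto those counted for `u`. Equality of ranks follows by exchanging `u` and `w`. -/
theorem slopeRank_le_of_slopeOrder_eq {u w : EuclideanSpace ℝ (Fin p)}
    (h : slopeOrder u = slopeOrder w) (i : Fin p) : slopeRank u i ≤ slopeRank w i := by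
  have hs : ∀ j, SignType.sign (u j) = SignType.sign (w j) := fun j =>
    congrFun (congrArg Prod.fst h) j
  have ho : ∀ j k, |u j| ≤ |u k| ↔ |w j| ≤ |w k| := fun j k =>
    iff_of_eq (congrFun (congrFun (congrArg Prod.snd h) j) k)
  have hz : ∀ j, 0 < |u j| ↔ 0 < |w j| := fun j => by
    rw [abs_pos, abs_pos, ← sign_ne_zero, hs, sign_ne_zero]
  have hfac : (fun j => |u j|).FactorsThrough fun j => |w j| := fun j k hjk =>
    le_antisymm ((ho j k).2 (le_of_eq hjk)) ((ho k j).2 (ge_of_eq hjk))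
  obtain ⟨φ, hφ⟩ := (Function.factorsThrough_iff _).1 hfac
  have hφ' : ∀ j, |u j| = φ |w j| := fun j => congrFun hφ j
  refine (Finset.card_le_card (t := ((Finset.univ.image fun j => |w j|).filter
    fun a => 0 < a ∧ a ≤ |w i|).image φ) ?_).trans Finset.card_image_le
  intro a ha
  simp only [Finset.mem_filter, Finset.mem_image, Finset.mem_univ, true_and] at ha
  obtain ⟨⟨j, rfl⟩, h0, hle⟩ := ha
  refine Finset.mem_image.2 ⟨|w j|, ?_, (hφ' j).symm⟩
  simp only [Finset.mem_filter, Finset.mem_image, Finset.mem_univ, true_and]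
  exact ⟨⟨j, rfl⟩, (hz j).1 h0, (ho j i).1 hle⟩

/-- Signs and ranks can be recovered from the pattern, and conversely. Signs and comparisons of
absolute values are much easier to handle than ranks for convexity and measurability. -/
theorem slopePattern_eq_iff {u w : EuclideanSpace ℝ (Fin p)} :
    slopePattern u = slopePattern w ↔ slopeOrder u = slopeOrder w := by
  constructor
  · intro h
    refine Prod.ext (funext fun i => ?_) (funext fun i => funext fun j => propext ?_)
    · simp only [slopeOrder]
      rw [← sign_slopePattern u, h, sign_slopePattern]
    · simp only [slopeOrder]
      rw [← slopeRank_le_slopeRank_iff, ← slopeRank_le_slopeRank_iff]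
      simp only [← natAbs_slopePattern, h]
  · intro h
    ext i
    rw [slopePattern_eq, slopePattern_eq, le_antisymm (slopeRank_le_of_slopeOrder_eq h i)
      (slopeRank_le_of_slopeOrder_eq h.symm i)]
    congr 2
    exact congrFun (congrArg Prod.fst h) i

theorem sign_add_of_sign_eq {x y a b : ℝ} (ha : 0 < a) (hb : 0 < b)
    (h : SignType.sign x = SignType.sign y) :
    SignType.sign (a * x + b * y) = SignType.sign x ∧ |a * x + b * y| = a * |x| + b * |y| := by
  rcases lt_trichotomy x 0 with hx | rfl | hx
  · have hy : y < 0 := sign_eq_neg_one_iff.1 (h ▸ sign_neg hx)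
    have := mul_neg_of_pos_of_neg ha hx
    have := mul_neg_of_pos_of_neg hb hy
    rw [sign_neg hx, sign_neg (by linarith), abs_of_neg hx, abs_of_neg hy,
      abs_of_neg (by linarith)]
    exact ⟨rfl, by ring⟩
  · have hy : y = 0 := sign_eq_zero_iff.1 (by rw [← h, sign_zero])
    simp [hy]
  · have hy : 0 < y := sign_eq_one_iff.1 (h ▸ sign_pos hx)
    have := mul_pos ha hx
    have := mul_pos hb hy
    rw [sign_pos hx, sign_pos (by linarith), abs_of_pos hx, abs_of_pos hy,
      abs_of_pos (by linarith)]
    exact ⟨rfl, rfl⟩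

/-- For vectors with equal coordinate signs, absolute values are additive under positive
combinations, so comparisons common to both vectors persist. -/
theorem convex_setOf_slopePattern_eq (m : Fin p → ℤ) :
    Convex ℝ {u : EuclideanSpace ℝ (Fin p) | slopePattern u = m} := by
  rw [convex_iff_forall_pos]
  intro x hx y hy a b ha hb _
  simp only [Set.mem_ofPred_eq] at hx hy ⊢
  have hxy : slopeOrder x = slopeOrder y := slopePattern_eq_iff.1 (hx.trans hy.symm)
  have hs : ∀ j, SignType.sign (x j) = SignType.sign (y j) := fun j =>
    congrFun (congrArg Prod.fst hxy) j
  have ho : ∀ j k, |x j| ≤ |x k| ↔ |y j| ≤ |y k| := fun j k =>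
    iff_of_eq (congrFun (congrFun (congrArg Prod.snd hxy) j) k)
  rw [← hx, slopePattern_eq_iff]
  refine Prod.ext (funext fun i => ?_) (funext fun i => funext fun j => propext ?_)
  · simpa [slopeOrder] using (sign_add_of_sign_eq ha hb (hs i)).1
  · have hi := (sign_add_of_sign_eq ha hb (hs i)).2
    have hj := (sign_add_of_sign_eq ha hb (hs j)).2
    simp only [slopeOrder, PiLp.add_apply, PiLp.smul_apply, smul_eq_mul]
    rw [hi, hj]
    constructor
    · intro h
      by_contra! hlt
      have h2 := (not_congr (ho i j)).1 (not_le.2 hlt)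
      nlinarith [mul_lt_mul_of_pos_left hlt ha, mul_lt_mul_of_pos_left (not_le.1 h2) hb]
    · intro h
      have h2 := (ho i j).1 h
      gcongr

theorem measurable_slopePattern :
    Measurable (slopePattern : EuclideanSpace ℝ (Fin p) → Fin p → ℤ) := by
  let _ : MeasurableSpace SignType := ⊤
  have : DiscreteMeasurableSpace SignType := ⟨fun _ => trivial⟩
  have hD : Measurable (slopeOrder : EuclideanSpace ℝ (Fin p) → _) := by
    refine Measurable.prodMk (measurable_pi_lambda _ fun i => ?_)
      (measurable_pi_lambda _ fun i => measurable_pi_lambda _ fun j => ?_)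
    · have hsign : Measurable (SignType.sign : ℝ → SignType) := by
        simp only [SignType.sign]
        exact Measurable.ite measurableSet_Ioi measurable_const
          (Measurable.ite measurableSet_Iio measurable_const measurable_const)
      exact hsign.comp (by fun_prop)
    · exact measurableSet_setOfPred.1 (measurableSet_le (by fun_prop) (by fun_prop))
  have hfac : (slopePattern : EuclideanSpace ℝ (Fin p) → Fin p → ℤ).FactorsThrough slopeOrder :=
    fun u w h => slopePattern_eq_iff.2 h
  obtain ⟨φ, hφ⟩ := (Function.factorsThrough_iff _).1 hfac
  rw [hφ]
  exact (measurable_of_countable φ).comp hD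

end SlopePattern

/-! ### Convexity and measurability of the active-set classes -/

section ActiveSet

variable {p N : ℕ} [NeZero N] (v : Fin N → EuclideanSpace ℝ (Fin p))
  (g : EuclideanSpace ℝ (Fin p) → ℝ)

theorem convex_setOf_activeSet_eq (J : MaxPattern N) :
    Convex ℝ {x | activeSet (piece v g) x = J} := by
  simp only [activeSet_eq_argmaxOn]
  exact convex_setOf_argmaxOn_eq v Finset.univ_nonempty J

instance (N : ℕ) : Finite (MaxPattern N) := inferInstanceAs (Finite (Finset (Fin N)))

theorem measurable_activeSet : Measurable (activeSet (piece v g)) := by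
  refine measurable_to_countable' fun J => ?_
  have : activeSet (piece v g) ⁻¹' {J} =
      {x | ∀ i, (i ∈ (show Finset (Fin N) from J) ↔ ∀ j, inner ℝ (v j) x ≤ inner ℝ (v i) x)} := by
    ext x
    simp only [Set.mem_preimage, activeSet_eq_argmaxOn, Set.mem_ofPred_eq]
    refine Finset.ext_iff.trans (forall_congr' fun i => ?_)
    rw [mem_argmaxOn]
    simp only [Finset.mem_univ, true_and, forall_const]
    exact Iff.comm
  rw [this]
  refine measurableSet_setOfPred.2 (Measurable.forall fun i => Measurable.iff measurable_const
    (Measurable.forall fun j => measurableSet_setOfPred.1 (measurableSet_le ?_ ?_))) <;> fun_prop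

end ActiveSet

/-! ### Independence of the sequence of pairs -/

section Independence

variable {Ω ι α β : Type*} [MeasurableSpace Ω] [MeasurableSpace α] [MeasurableSpace β]
  {P : Measure Ω} {X : ι → Ω → α} {Y : ι → Ω → β}

/-- Measurable rectangles form a generating π-system, and on rectangles the joint probability
factors through the independence of the two sequences and then within each. -/
theorem iIndepFun_prodMk_of_measurable [Countable ι] (mX : ∀ i, Measurable (X i))
    (mY : ∀ i, Measurable (Y i)) (hX : iIndepFun X P) (hY : iIndepFun Y P)
    (hXY : IndepFun (fun ω i => X i ω) (fun ω i => Y i ω) P) :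
    iIndepFun (fun i ω => (X i ω, Y i ω)) P := by
  rw [iIndepFun_iff_iIndep]
  let R : Set (Set (α × β)) := Set.image2 (· ×ˢ ·) {s | MeasurableSet s} {t | MeasurableSet t}
  refine iIndepSets.iIndep (fun i => ((mX i).prodMk (mY i)).comap_le)
    (fun i => Set.preimage (fun ω => (X i ω, Y i ω)) '' R) (fun i => ?_) (fun i => ?_) ?_
  · exact isPiSystem_prod.comap _
  · change MeasurableSpace.comap _ Prod.instMeasurableSpace = _
    rw [← generateFrom_prod, MeasurableSpace.comap_generateFrom]
  · rw [iIndepSets_iff]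
    intro s f hf
    have hf' : ∀ i, ∃ A : Set α, ∃ B : Set β, MeasurableSet A ∧ MeasurableSet B ∧
        (i ∈ s → f i = X i ⁻¹' A ∩ Y i ⁻¹' B) := fun i => by
      by_cases hi : i ∈ s
      · obtain ⟨_, ⟨A, hA, B, hB, rfl⟩, hfi⟩ := hf i hi
        exact ⟨A, B, hA, hB, fun _ => hfi ▸ rfl⟩
      -- Outside `s` the choice is irrelevant.
      · exact ⟨∅, ∅, .empty, .empty, fun h => absurd h hi⟩
    choose A B hA hB hAB using hf'
    have h1 : (⋂ i ∈ s, f i) = (fun ω i => X i ω) ⁻¹' (Set.pi s A)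
        ∩ (fun ω i => Y i ω) ⁻¹' (Set.pi s B) := by
      ext ω
      simp only [Set.mem_iInter, Set.mem_inter_iff, Set.mem_preimage, Set.mem_pi, Finset.mem_coe,
        ← forall_and]
      exact forall₂_congr fun i hi => by rw [hAB i hi]; rfl
    have h2 : (fun ω i => X i ω) ⁻¹' (Set.pi s A) = ⋂ i ∈ s, X i ⁻¹' A i := by
      ext ω; simp [Set.mem_pi]
    have h3 : (fun ω i => Y i ω) ⁻¹' (Set.pi s B) = ⋂ i ∈ s, Y i ⁻¹' B i := by
      ext ω; simp [Set.mem_pi]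
    rw [h1, hXY.measure_inter_preimage_eq_mul _ _ (.pi (Finset.countable_toSet s) fun i _ => hA i)
      (.pi (Finset.countable_toSet s) fun i _ => hB i), h2, h3,
      hX.measure_inter_preimage_eq_mul s (fun i _ => hA i),
      hY.measure_inter_preimage_eq_mul s (fun i _ => hB i), ← Finset.prod_mul_distrib]
    refine Finset.prod_congr rfl fun i hi => ?_
    have := hXY.measure_inter_preimage_eq_mul (Function.eval i ⁻¹' A i) (Function.eval i ⁻¹' B i)
      (measurable_pi_apply i (hA i)) (measurable_pi_apply i (hB i))
    rw [hAB i hi]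
    exact this.symm

/-- Two independent sequences of independent variables form an independent sequence of pairs. -/
theorem iIndepFun_prodMk [Countable ι] (mX : ∀ i, AEMeasurable (X i) P)
    (mY : ∀ i, AEMeasurable (Y i) P) (hX : iIndepFun X P) (hY : iIndepFun Y P)
    (hXY : IndepFun (fun ω i => X i ω) (fun ω i => Y i ω) P) :
    iIndepFun (fun i ω => (X i ω, Y i ω)) P := by
  have h := iIndepFun_prodMk_of_measurable (fun i => (mX i).measurable_mk)
    (fun i => (mY i).measurable_mk) (hX.congr fun i => (mX i).ae_eq_mk)
    (hY.congr fun i => (mY i).ae_eq_mk) (hXY.congr ?_ ?_)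
  · refine h.congr fun i => ?_
    filter_upwards [(mX i).ae_eq_mk, (mY i).ae_eq_mk] with ω h1 h2
    rw [h1, h2]
  · filter_upwards [ae_all_iff.2 fun i => (mX i).ae_eq_mk] with ω h
    exact funext h
  · filter_upwards [ae_all_iff.2 fun i => (mY i).ae_eq_mk] with ω h
    exact funext h

end Independence

/-! ### Weak convergence on countable discrete spaces -/

section DiscreteConvergence

/-- On a countable discrete space, pointwise convergence of the probability masses implies
convergence in distribution. -/
theorem tendstoInDistribution_of_tendsto_singleton {Ω Ω' T : Type*} [MeasurableSpace Ω]
    [MeasurableSpace Ω'] {P : Measure Ω} {P' : Measure Ω'} [IsProbabilityMeasure P]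
    [IsProbabilityMeasure P'] [Countable T] [MeasurableSpace T] [TopologicalSpace T]
    [DiscreteTopology T] [OpensMeasurableSpace T] {Y : ℕ → Ω → T} {Z : Ω' → T}
    (hY : ∀ n, AEMeasurable (Y n) P) (hZ : AEMeasurable Z P')
    (h : ∀ m, Tendsto (fun n => P {ω | Y n ω = m}) atTop (𝓝 (P' {ω | Z ω = m}))) :
    TendstoInDistribution Y atTop Z (fun _ => P) P' := by
  have hmeas : ∀ s : Set T, MeasurableSet s := fun s => (isOpen_discrete s).measurableSet
  have : MeasurableSingletonClass T := ⟨fun x => hmeas _⟩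
  refine ⟨hY, hZ, tendsto_of_forall_isOpen_le_liminf_nat' fun G _ => ?_⟩
  change P'.map Z G ≤ liminf (fun n => P.map (Y n) G) atTop
  have hG : ∀ μ : Measure T, μ G = ∑' x : G, μ {(x : T)} := fun μ => by
    rw [← measure_iUnion (fun x y hxy => by simpa using Subtype.coe_injective.ne hxy)
      (fun x => hmeas _), Set.iUnion_of_singleton_coe]
  rw [hG, ENNReal.tsum_eq_iSup_sum]
  -- The mass of an open set is a supremum of finite sums of point masses, each finite sum
  -- converges, and so the lower bound required by the portmanteau theorem follows.
  refine iSup_le fun F => ?_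
  have hlim : Tendsto (fun n => ∑ x ∈ F, P.map (Y n) {(x : T)}) atTop
      (𝓝 (∑ x ∈ F, P'.map Z {(x : T)})) := by
    refine tendsto_finsetSum _ fun x _ => ?_
    simp only [Measure.map_apply_of_aemeasurable (hY _) (hmeas {(x : T)}),
      Measure.map_apply_of_aemeasurable hZ (hmeas {(x : T)})]
    exact h x
  rw [← hlim.liminf_eq]
  refine liminf_le_liminf (.of_forall fun n => ?_)
  rw [hG]
  exact ENNReal.sum_le_tsum F

end DiscreteConvergence

/-! ### Absolute continuity of nondegenerate Gaussian laws -/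

section Gaussian

theorem pi_gaussianReal_absolutelyContinuous {ι : Type*} [Fintype ι] :
    Measure.pi (fun _ : ι => gaussianReal 0 1) ≪ volume := by
  have hdens : Measure.pi (fun _ : ι => gaussianReal 0 1) =
      (volume : Measure (ι → ℝ)).withDensity
        (fun x => ENNReal.ofReal (∏ i, gaussianPDFReal 0 1 (x i))) := by
    refine Measure.pi_eq fun s hs => ?_
    have hint : Integrable (fun x : ι → ℝ => ∏ i, gaussianPDFReal 0 1 (x i)) :=
      Integrable.fintype_prod fun _ => integrable_gaussianPDFReal 0 1
    rw [withDensity_apply _ (.univ_pi hs), ← ofReal_integral_eq_lintegral_ofReal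
      hint.restrict (.of_forall fun x => Finset.prod_nonneg fun i _ => gaussianPDFReal_nonneg 0 1 _),
      volume_pi, Measure.restrict_pi_pi, integral_fintype_prod_eq_prod,
      ENNReal.ofReal_prod_of_nonneg
        (fun i _ => integral_nonneg fun x => gaussianPDFReal_nonneg 0 1 x)]
    refine Finset.prod_congr rfl fun i _ => ?_
    rw [gaussianReal_apply_eq_integral 0 one_ne_zero]
  rw [hdens]
  exact withDensity_absolutelyContinuous _ _

theorem stdGaussian_absolutelyContinuous {ι : Type*} [Fintype ι] :
    stdGaussian (EuclideanSpace ℝ ι) ≪ volume := by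
  rw [← map_pi_eq_stdGaussian, ← (PiLp.volume_preserving_toLp ι).map_eq]
  exact pi_gaussianReal_absolutelyContinuous.map (by fun_prop)

open scoped MatrixOrder Matrix.Norms.L2Operator in
theorem multivariateGaussian_absolutelyContinuous {ι : Type*} [Fintype ι] [DecidableEq ι]
    (μ : EuclideanSpace ℝ ι) {S : Matrix ι ι ℝ} (hS : S.PosDef) :
    multivariateGaussian μ S ≪ volume := by
  set L := Matrix.toEuclideanCLM (n := ι) (𝕜 := ℝ) (CFC.sqrt S) with hL
  have hu : IsUnit L := by
    refine IsUnit.map _ ?_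
    rw [CFC.isUnit_sqrt_iff S hS.posSemidef.nonneg]
    exact hS.isUnit
  obtain ⟨e, he⟩ : ∃ e : EuclideanSpace ℝ ι ≃L[ℝ] EuclideanSpace ℝ ι, ∀ x, e x = L x := by
    obtain ⟨e, he⟩ := hu
    exact ⟨ContinuousLinearEquiv.unitsEquiv ℝ _ e, fun x => by rw [← he]; rfl⟩
  intro s hs
  obtain ⟨t, hst, ht, ht0⟩ := exists_measurable_superset_of_null hs
  refine measure_mono_null hst ?_
  rw [multivariateGaussian, Measure.map_apply (by fun_prop) ht]
  refine stdGaussian_absolutelyContinuous ?_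
  -- Positive definiteness makes the square root of `S` invertible, so the preimage is the image of
  -- a translate of `t` under a linear isomorphism, hence null.
  have : (fun x => μ + L x) ⁻¹' t = e.symm '' ((fun x => -μ + x) '' t) := by
    ext x
    simp only [Set.mem_preimage, Set.image_image, Set.mem_image]
    constructor
    · exact fun h => ⟨_, h, by simp [← he]⟩
    · rintro ⟨y, hy, rfl⟩
      simpa [← he] using hy
  rw [this]
  have h2 := Measure.addHaar_image_continuousLinearMap (volume : Measure (EuclideanSpace ℝ ι))
    (e.symm : EuclideanSpace ℝ ι →L[ℝ] EuclideanSpace ℝ ι) ((fun x => -μ + x) '' t)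
  refine h2.trans ?_
  rw [Set.image_add_left, measure_preimage_add, ht0, mul_zero]

end Gaussian

/-! ### Law of large numbers for `C_n` and central limit theorem for `W_n` -/

section LimitTheorems

variable {p : ℕ} {Ω : Type*} [MeasurableSpace Ω] {P : Measure Ω}
  {X : ℕ → Ω → EuclideanSpace ℝ (Fin p)} {ε : ℕ → Ω → ℝ} {C : Matrix (Fin p) (Fin p) ℝ} {σ : ℝ}

theorem score_eq (X : ℕ → EuclideanSpace ℝ (Fin p)) (e : ℕ → ℝ) (n : ℕ) :
    score X e n = (√(n : ℝ))⁻¹ • ∑ k ∈ Finset.range n, e k • X k := by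
  ext j
  simp [score, Matrix.mulVec, dotProduct, designMatrix, Finset.sum_range, mul_comm]

theorem inner_score (X : ℕ → EuclideanSpace ℝ (Fin p)) (e : ℕ → ℝ) (n : ℕ)
    (t : EuclideanSpace ℝ (Fin p)) :
    inner ℝ (score X e n) t = (√(n : ℝ))⁻¹ * ∑ k ∈ Finset.range n, inner ℝ (X k) t * e k := by
  rw [score_eq, real_inner_smul_left, sum_inner]
  simp only [real_inner_smul_left, mul_comm]

theorem empCov_apply (X : ℕ → EuclideanSpace ℝ (Fin p)) (n : ℕ) (j k : Fin p) :
    empCov X n j k = (∑ i ∈ Finset.range n, X i j * X i k) / n := by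
  simp [empCov, Matrix.mul_apply, designMatrix, Finset.sum_range, div_eq_inv_mul]

theorem aemeasurable_score (hX : ∀ i, AEMeasurable (X i) P) (hε : ∀ i, AEMeasurable (ε i) P)
    (n : ℕ) : AEMeasurable (fun ω => score (fun i => X i ω) (fun i => ε i ω) n) P := by
  simp only [score_eq]
  exact (Finset.aemeasurable_fun_sum _ fun k _ => (hε k).smul (hX k)).const_smul (√(n : ℝ))⁻¹

theorem aemeasurable_toEuclideanCLM_empCov (hX : ∀ i, AEMeasurable (X i) P)
    {u : Ω → EuclideanSpace ℝ (Fin p)} (hu : AEMeasurable u P) (n : ℕ) :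
    AEMeasurable (fun ω => Matrix.toEuclideanCLM (𝕜 := ℝ) (empCov (fun i => X i ω) n) (u ω)) P := by
  have hcoord : ∀ {w : Ω → EuclideanSpace ℝ (Fin p)} (j : Fin p), AEMeasurable w P →
      AEMeasurable (fun ω => w ω j) P := fun j hw =>
    (EuclideanSpace.proj (𝕜 := ℝ) j).continuous.measurable.comp_aemeasurable hw
  have : ∀ ω, Matrix.toEuclideanCLM (𝕜 := ℝ) (empCov (fun i => X i ω) n) (u ω) =
      WithLp.toLp 2 (fun j => ∑ k, (∑ i ∈ Finset.range n, X i ω j * X i ω k) / n * u ω k) := by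
    intro ω
    ext j
    rw [Matrix.ofLp_toEuclideanCLM]
    simp [Matrix.mulVec, dotProduct, empCov_apply]
  simp only [this]
  refine (WithLp.measurable_toLp 2 _).comp_aemeasurable (aemeasurable_pi_lambda _ fun j => ?_)
  exact Finset.aemeasurable_fun_sum _ fun k _ => ((Finset.aemeasurable_fun_sum _ fun i _ =>
    (hcoord j (hX i)).mul (hcoord k (hX i))).div_const _).mul (hcoord k hu)

theorem memLp_apply {Y : Ω → EuclideanSpace ℝ (Fin p)} (hY : MemLp Y 2 P) (j : Fin p) :
    MemLp (fun ω => Y ω j) 2 P :=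
  (EuclideanSpace.proj (𝕜 := ℝ) j).comp_memLp' hY

variable [IsProbabilityMeasure P]

theorem integral_apply_eq_zero {Y : Ω → EuclideanSpace ℝ (Fin p)} (hY : MemLp Y 2 P)
    (h0 : ∫ ω, Y ω ∂P = 0) (j : Fin p) : ∫ ω, Y ω j ∂P = 0 := by
  have := (EuclideanSpace.proj (𝕜 := ℝ) j).integral_comp_comm (hY.integrable one_le_two)
  rw [h0, map_zero] at this
  exact this

theorem integral_mul_apply_eq {Y : Ω → EuclideanSpace ℝ (Fin p)} (hY : MemLp Y 2 P)
    (h0 : ∫ ω, Y ω ∂P = 0) (j k : Fin p) :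
    ∫ ω, Y ω j * Y ω k ∂P = covariance (fun ω => Y ω j) (fun ω => Y ω k) P := by
  rw [covariance_eq_sub (memLp_apply hY j) (memLp_apply hY k), integral_apply_eq_zero hY h0 j]
  simp

/-- Strong law of large numbers for the empirical covariance matrix. -/
theorem ae_tendsto_empCov (hX_indep : iIndepFun X P) (hX_ident : ∀ i, IdentDistrib (X i) (X 0) P P)
    (hX_L2 : MemLp (X 0) 2 P) (hX_mean : ∫ ω, X 0 ω ∂P = 0)
    (hX_cov : ∀ j k, covariance (fun ω => X 0 ω j) (fun ω => X 0 ω k) P = C j k) :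
    ∀ᵐ ω ∂P, Tendsto (fun n => empCov (fun i => X i ω) n) atTop (𝓝 C) := by
  have hjk : ∀ j k, ∀ᵐ ω ∂P,
      Tendsto (fun n => empCov (fun i => X i ω) n j k) atTop (𝓝 (C j k)) := by
    intro j k
    have hm : Measurable fun x : EuclideanSpace ℝ (Fin p) => x j * x k := by fun_prop
    have := strong_law_ae_real (μ := P) (fun i ω => X i ω j * X i ω k)
      ((memLp_apply hX_L2 j).integrable_mul (memLp_apply hX_L2 k))
      (fun a b hab => (hX_indep.indepFun hab).comp hm hm)
      (fun i => (hX_ident i).comp hm)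
    rw [integral_mul_apply_eq hX_L2 hX_mean, hX_cov] at this
    simpa only [empCov_apply] using this
  filter_upwards [ae_all_iff.2 fun j => ae_all_iff.2 (hjk j)] with ω hω
  exact tendsto_pi_nhds.2 fun j => tendsto_pi_nhds.2 fun k => hω j k

theorem tendsto_norm_sub_toEuclideanCLM {A : ℕ → Matrix (Fin p) (Fin p) ℝ}
    (h : Tendsto A atTop (𝓝 C)) :
    Tendsto (fun n => ‖Matrix.toEuclideanCLM (𝕜 := ℝ) C - Matrix.toEuclideanCLM (𝕜 := ℝ) (A n)‖)
      atTop (𝓝 0) := by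
  have hc : Continuous (Matrix.toEuclideanCLM (n := Fin p) (𝕜 := ℝ)) :=
    LinearMap.continuous_of_finiteDimensional
      (Matrix.toEuclideanCLM (n := Fin p) (𝕜 := ℝ)).toAlgEquiv.toLinearMap
  have h1 := tendsto_iff_norm_sub_tendsto_zero.1 ((hc.tendsto C).comp h)
  refine h1.congr fun n => ?_
  rw [Function.comp_apply, norm_sub_rev]

theorem variance_inner {Y : Ω → EuclideanSpace ℝ (Fin p)} (hY : MemLp Y 2 P)
    (hcov : ∀ j k, covariance (fun ω => Y ω j) (fun ω => Y ω k) P = C j k)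
    (t : EuclideanSpace ℝ (Fin p)) :
    variance (fun ω => inner ℝ (Y ω) t) P = dotProduct t.ofLp (C.mulVec t.ofLp) := by
  have : (fun ω => inner ℝ (Y ω) t) = fun ω => ∑ j, t j * Y ω j := by
    ext ω; simp [PiLp.inner_apply]
  rw [this, variance_fun_sum fun j => (memLp_apply hY j).const_mul (t j)]
  simp only [covariance_const_mul_left, covariance_const_mul_right, hcov, dotProduct,
    Matrix.mulVec, Finset.mul_sum]
  exact Finset.sum_congr rfl fun j _ => Finset.sum_congr rfl fun k _ => by ring

/-- Central limit theorem for the score. -/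
theorem tendstoInDistribution_score (hC : C.PosDef)
    (hX_indep : iIndepFun X P) (hX_ident : ∀ i, IdentDistrib (X i) (X 0) P P)
    (hX_L2 : MemLp (X 0) 2 P) (hX_mean : ∫ ω, X 0 ω ∂P = 0)
    (hX_cov : ∀ j k, covariance (fun ω => X 0 ω j) (fun ω => X 0 ω k) P = C j k)
    (hε_indep : iIndepFun ε P) (hε_ident : ∀ i, IdentDistrib (ε i) (ε 0) P P)
    (hε_L2 : MemLp (ε 0) 2 P) (hε_mean : ∫ ω, ε 0 ω ∂P = 0)
    (hε_var : variance (ε 0) P = σ ^ 2)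
    (hXε : IndepFun (fun ω i => X i ω) (fun ω i => ε i ω) P)
    {Ω' : Type*} [MeasurableSpace Ω'] {P' : Measure Ω'} [IsProbabilityMeasure P']
    {W : Ω' → EuclideanSpace ℝ (Fin p)} (hW : HasLaw W (multivariateGaussian 0 (σ ^ 2 • C)) P') :
    TendstoInDistribution (fun n ω => score (fun i => X i ω) (fun i => ε i ω) n) atTop W
      (fun _ => P) P' := by
  have mX i := (hX_ident i).aemeasurable_fst
  have mε i := (hε_ident i).aemeasurable_fst
  refine ⟨aemeasurable_score mX mε, hW.aemeasurable, ?_⟩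
  -- Cramér–Wold reduction: the characteristic function of the score at `t` is that of its
  -- projection on `t`, evaluated at `1`. The projection is a normalised sum of the i.i.d. scalars
  -- `⟨X k, t⟩ ε k`, to which the real central limit theorem applies.
  refine ProbabilityMeasure.tendsto_iff_tendsto_charFun.2 fun t => ?_
  change Tendsto (fun n => charFun (P.map fun ω => score (fun i => X i ω) (fun i => ε i ω) n) t)
    atTop (𝓝 (charFun (P'.map W) t))
  have hS : (σ ^ 2 • C).PosSemidef := hC.posSemidef.smul (sq_nonneg σ)
  rw [hW.map_eq, charFun_multivariateGaussian hS]
  have hpair := iIndepFun_prodMk mX mε hX_indep hε_indep hXε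
  have hφ : Measurable fun z : EuclideanSpace ℝ (Fin p) × ℝ => inner ℝ z.1 t * z.2 := by fun_prop
  have h0 : IndepFun (X 0) (ε 0) P :=
    hXε.comp (measurable_pi_apply 0) (measurable_pi_apply 0)
  have hpident : ∀ i, IdentDistrib (fun ω => (X i ω, ε i ω)) (fun ω => (X 0 ω, ε 0 ω)) P P :=
    fun i => (hX_ident i).prodMk (hε_ident i)
      (hXε.comp (measurable_pi_apply i) (measurable_pi_apply i)) h0
  have hinner : Measurable fun x : EuclideanSpace ℝ (Fin p) => inner ℝ x t := by fun_prop
  have h0t : IndepFun (fun ω => inner ℝ (X 0 ω) t) (ε 0) P := h0.comp hinner measurable_id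
  have hL2t : MemLp (fun ω => inner ℝ (X 0 ω) t) 2 P := hX_L2.inner_const t
  have hsq : ∫ ω, (inner ℝ (X 0 ω) t * ε 0 ω) ^ 2 ∂P
      = dotProduct t.ofLp ((σ ^ 2 • C).mulVec t.ofLp) := by
    have hi : IndepFun (fun ω => inner ℝ (X 0 ω) t ^ 2) (fun ω => ε 0 ω ^ 2) P :=
      h0t.comp (measurable_id.pow_const 2) (measurable_id.pow_const 2)
    have hm : ∫ ω, inner ℝ (X 0 ω) t ∂P = 0 := by
      have := integral_inner (𝕜 := ℝ) (hX_L2.integrable one_le_two) t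
      rw [hX_mean, inner_zero_right] at this
      simpa only [real_inner_comm] using this
    simp only [mul_pow]
    rw [hi.integral_fun_mul_eq_mul_integral (hL2t.aestronglyMeasurable.pow 2)
      (hε_L2.aestronglyMeasurable.pow 2),
      ← variance_of_integral_eq_zero hL2t.aemeasurable hm,
      ← variance_of_integral_eq_zero hε_L2.aemeasurable hε_mean, hε_var,
      variance_inner hX_L2 hX_cov, Matrix.smul_mulVec, dotProduct_smul, smul_eq_mul, mul_comm]
  have hmean : ∫ ω, inner ℝ (X 0 ω) t * ε 0 ω ∂P = 0 := by
    rw [h0t.integral_fun_mul_eq_mul_integral hL2t.aestronglyMeasurable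
      hε_L2.aestronglyMeasurable, hε_mean, mul_zero]
  have hL2 : MemLp (fun ω => inner ℝ (X 0 ω) t * ε 0 ω) 2 P := by
    refine (memLp_two_iff_integrable_sq
      (hL2t.aestronglyMeasurable.mul hε_L2.aestronglyMeasurable)).2 ?_
    simp only [Pi.mul_apply, mul_pow]
    exact IndepFun.integrable_mul (h0t.comp (measurable_id.pow_const 2) (measurable_id.pow_const 2))
      hL2t.integrable_sq hε_L2.integrable_sq
  have hvar : variance (fun ω => inner ℝ (X 0 ω) t * ε 0 ω) P
      = dotProduct t.ofLp ((σ ^ 2 • C).mulVec t.ofLp) := by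
    rw [variance_of_integral_eq_zero hL2.aemeasurable hmean, hsq]
  have hclt := tendstoInDistribution_inv_sqrt_mul_sum_sub (P := P)
    (X := fun k ω => inner ℝ (X k ω) t * ε k ω)
    (HasLaw.id (μ := gaussianReal 0 (variance (fun ω => inner ℝ (X 0 ω) t * ε 0 ω) P).toNNReal))
    hL2 (hpair.comp (fun _ => _) fun _ => hφ) (fun i => (hpident i).comp hφ)
  have hlim := ProbabilityMeasure.tendsto_iff_tendsto_charFun.1 hclt.tendsto 1
  simp only [ProbabilityMeasure.coe_mk, Measure.map_id, charFun_gaussianReal, hmean] at hlim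
  have hnn : 0 ≤ dotProduct t.ofLp ((σ ^ 2 • C).mulVec t.ofLp) := hvar ▸ variance_nonneg _ _
  convert hlim using 2 with n
  · rw [charFun_apply, charFun_apply_real, integral_map (aemeasurable_score mX mε n) (by fun_prop),
      integral_map (hclt.forall_aemeasurable n |>.congr (by simp [hmean])) (by fun_prop)]
    simp [inner_score]
  · rw [hvar, Real.coe_toNNReal _ hnn]
    simp

end LimitTheorems

/-! ### Tightness and portmanteau arguments -/

section WeakConvergence

theorem exists_eventually_measure_norm_lt {Ω Ω' E : Type*} [MeasurableSpace Ω] [MeasurableSpace Ω']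
    {P : Measure Ω} {P' : Measure Ω'} [IsProbabilityMeasure P] [IsProbabilityMeasure P']
    [NormedAddCommGroup E] [ProperSpace E] [SecondCountableTopology E]
    [MeasurableSpace E] [BorelSpace E] {Y : ℕ → Ω → E} {Z : Ω' → E}
    (h : TendstoInDistribution Y atTop Z (fun _ => P) P') {δ : ENNReal} (hδ : 0 < δ) :
    ∃ R > 0, ∀ᶠ n in atTop, P {ω | R ≤ ‖Y n ω‖} < δ := by
  have hZ := h.aemeasurable_limit
  have : IsProbabilityMeasure (P'.map Z) := Measure.isProbabilityMeasure_map hZ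
  have htight := tendsto_measure_norm_gt_of_isTightMeasureSet
    (isTightMeasureSet_singleton (μ := P'.map Z))
  simp only [Set.mem_singleton_iff, iSup_iSup_eq_left] at htight
  obtain ⟨r, hr0, hr⟩ := ((eventually_gt_atTop (0 : ℝ)).and
    (htight.eventually_lt_const hδ)).exists
  -- The radius `r + 1` replaces the strict tail `r < ‖x‖` by a closed set, as the limsup bound
  -- requires.
  have hclosed : IsClosed {x : E | r + 1 ≤ ‖x‖} := isClosed_le continuous_const continuous_norm
  have hlim := ProbabilityMeasure.limsup_measure_closed_le_of_tendsto h.tendsto hclosed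
  have hlt : P'.map Z {x : E | r + 1 ≤ ‖x‖} < δ :=
    (measure_mono fun x (hx : r + 1 ≤ ‖x‖) => show r < ‖x‖ by linarith).trans_lt hr
  refine ⟨r + 1, by positivity, (eventually_lt_of_limsup_lt (hlim.trans_lt hlt)).mono ?_⟩
  intro n hn
  change P.map (Y n) _ < δ at hn
  rwa [Measure.map_apply_of_aemeasurable (h.forall_aemeasurable n) hclosed.measurableSet] at hn

/-- Portmanteau theorem for a possibly non-measurable set with null boundary, in terms of outer
probabilities. -/
theorem tendsto_measure_mem_of_null_frontier {Ω Ω' E : Type*} [MeasurableSpace Ω]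
    [MeasurableSpace Ω'] {P : Measure Ω} {P' : Measure Ω'} [IsProbabilityMeasure P]
    [IsProbabilityMeasure P'] [TopologicalSpace E] [HasOuterApproxClosed E]
    [MeasurableSpace E] [BorelSpace E] {Y : ℕ → Ω → E} {Z : Ω' → E}
    (h : TendstoInDistribution Y atTop Z (fun _ => P) P') {A : Set E}
    (hA : P'.map Z (frontier A) = 0) :
    Tendsto (fun n => P {ω | Y n ω ∈ A}) atTop (𝓝 (P' {ω | Z ω ∈ A})) := by
  have hZ := h.aemeasurable_limit
  have key : ∀ B : Set E, MeasurableSet B → frontier B ⊆ frontier A →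
      Tendsto (fun n => P {ω | Y n ω ∈ B}) atTop (𝓝 (P' {ω | Z ω ∈ B})) := by
    intro B hB hBA
    have := ProbabilityMeasure.tendsto_measure_of_null_frontier_of_tendsto' h.tendsto
      (E := B) (measure_mono_null hBA hA)
    simp only [ProbabilityMeasure.coe_mk, Measure.map_apply_of_aemeasurable hZ hB,
      Measure.map_apply_of_aemeasurable (h.forall_aemeasurable _) hB] at this
    exact this
  -- `A` is squeezed between its interior and its closure. Both are measurable with frontier inside
  -- that of `A`, and they have the same limiting mass.
  have hdiff : P' {ω | Z ω ∈ closure A \ interior A} = 0 := by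
    rwa [Measure.map_apply_of_aemeasurable hZ isClosed_frontier.measurableSet] at hA
  have hle : P' {ω | Z ω ∈ closure A} ≤ P' {ω | Z ω ∈ interior A} := by
    refine (measure_mono (t := {ω | Z ω ∈ interior A} ∪ {ω | Z ω ∈ closure A \ interior A})
      fun ω hω => ?_).trans ((measure_union_le _ _).trans_eq (by rw [hdiff, add_zero]))
    by_cases hi : Z ω ∈ interior A
    · exact Or.inl hi
    · exact Or.inr ⟨hω, hi⟩
  have h1 : P' {ω | Z ω ∈ interior A} ≤ P' {ω | Z ω ∈ A} :=
    measure_mono fun ω hω => interior_subset (s := A) hω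
  have h2 : P' {ω | Z ω ∈ A} ≤ P' {ω | Z ω ∈ closure A} :=
    measure_mono fun ω hω => subset_closure hω
  have hint := key _ isOpen_interior.measurableSet frontier_interior_subset
  have hcl := key _ isClosed_closure.measurableSet frontier_closure_subset
  rw [le_antisymm h1 (h2.trans hle)] at hint
  rw [le_antisymm (hle.trans h1) h2] at hcl
  exact tendsto_of_tendsto_of_tendsto_of_le_of_le hint hcl
    (fun n => measure_mono fun ω hω => interior_subset (s := A) hω)
    (fun n => measure_mono fun ω hω => subset_closure hω)

/-- If the events `A n` and `B n` agree outside of sets of arbitrarily small probability, then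
their probabilities have the same limit. -/
theorem tendsto_measure_of_eventually_iff {Ω : Type*} [MeasurableSpace Ω]
    {P : Measure Ω} {A B : ℕ → Set Ω} {l : ENNReal} (hl : l ≠ ⊤)
    (hA : Tendsto (fun n => P (A n)) atTop (𝓝 l))
    (hAB : ∀ δ : ENNReal, 0 < δ → ∃ G : ℕ → Set Ω, ∀ᶠ n in atTop, P (G n)ᶜ ≤ δ ∧
      ∀ ω ∈ G n, ω ∈ A n ↔ ω ∈ B n) :
    Tendsto (fun n => P (B n)) atTop (𝓝 l) := by
  rw [ENNReal.tendsto_nhds hl] at hA ⊢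
  intro δ hδ
  obtain ⟨G, hG⟩ := hAB (δ / 2) (ENNReal.half_pos hδ.ne')
  filter_upwards [hA (δ / 2) (ENNReal.half_pos hδ.ne'), hG] with n hn ⟨hGn, hiff⟩
  have h1 : P (A n) ≤ P (B n) + δ / 2 := by
    refine (measure_mono (t := B n ∪ (G n)ᶜ) fun ω hω => ?_).trans
      ((measure_union_le _ _).trans (by gcongr))
    by_cases h : ω ∈ G n
    · exact Or.inl ((hiff ω h).1 hω)
    · exact Or.inr h
  have h2 : P (B n) ≤ P (A n) + δ / 2 := by
    refine (measure_mono (t := A n ∪ (G n)ᶜ) fun ω hω => ?_).trans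
      ((measure_union_le _ _).trans (by gcongr))
    by_cases h : ω ∈ G n
    · exact Or.inl ((hiff ω h).2 hω)
    · exact Or.inr h
  constructor
  · rw [tsub_le_iff_right]
    calc l ≤ P (A n) + δ / 2 := tsub_le_iff_right.1 hn.1
      _ ≤ P (B n) + δ / 2 + δ / 2 := by gcongr
      _ = P (B n) + δ := by rw [add_assoc, ENNReal.add_halves]
  · calc P (B n) ≤ P (A n) + δ / 2 := h2
      _ ≤ l + δ / 2 + δ / 2 := by gcongr; exact hn.2
      _ = l + δ := by rw [add_assoc, ENNReal.add_halves]

end WeakConvergence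

/-! ### The estimator as solution of a perturbed limiting inclusion -/

section Estimator

variable {p N : ℕ} [NeZero N] {v : Fin N → EuclideanSpace ℝ (Fin p)}
  {g : EuclideanSpace ℝ (Fin p) → ℝ} {β₀ : EuclideanSpace ℝ (Fin p)}
  {Ω : Type*}
  {X : ℕ → Ω → EuclideanSpace ℝ (Fin p)} {ε : ℕ → Ω → ℝ}
  {C : Matrix (Fin p) (Fin p) ℝ} {uHat : ℕ → Ω → EuclideanSpace ℝ (Fin p)}

/-- The event that `uHat n` is a minimiser of norm at most `R`, and that `C_n` is `η`-close
to `C`. -/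
def goodEvent (v : Fin N → EuclideanSpace ℝ (Fin p)) (g : EuclideanSpace ℝ (Fin p) → ℝ)
    (β₀ : EuclideanSpace ℝ (Fin p)) (X : ℕ → Ω → EuclideanSpace ℝ (Fin p)) (ε : ℕ → Ω → ℝ)
    (C : Matrix (Fin p) (Fin p) ℝ) (uHat : ℕ → Ω → EuclideanSpace ℝ (Fin p)) (R η : ℝ) (n : ℕ) :
    Set Ω :=
  {ω | IsMinOn (rescaledObjective (maxFun (piece v g)) β₀ (fun i => X i ω) (fun i => ε i ω) n)
      Set.univ (uHat n ω) ∧ ‖uHat n ω‖ ≤ R ∧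
    ‖Matrix.toEuclideanCLM (𝕜 := ℝ) C
      - Matrix.toEuclideanCLM (𝕜 := ℝ) (empCov (fun i => X i ω) n)‖ ≤ η}

/-- The part of the first-order condition for `uHat n` which depends on `uHat n`, apart from
the term `C uHat n` of the limiting problem. -/
def remainder (g : EuclideanSpace ℝ (Fin p) → ℝ) (β₀ : EuclideanSpace ℝ (Fin p))
    (X : ℕ → Ω → EuclideanSpace ℝ (Fin p)) (C : Matrix (Fin p) (Fin p) ℝ)
    (uHat : ℕ → Ω → EuclideanSpace ℝ (Fin p)) (n : ℕ) (ω : Ω) : EuclideanSpace ℝ (Fin p) :=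
  (gradient g β₀ - gradient g (β₀ + (√(n : ℝ))⁻¹ • uHat n ω)) +
    (Matrix.toEuclideanCLM (𝕜 := ℝ) C (uHat n ω)
      - Matrix.toEuclideanCLM (𝕜 := ℝ) (empCov (fun i => X i ω) n) (uHat n ω))

theorem tendsto_inv_sqrt_mul (R : ℝ) :
    Tendsto (fun n : ℕ => (√(n : ℝ))⁻¹ * R) atTop (𝓝 0) := by
  rw [← zero_mul R]
  exact (tendsto_inv_atTop_zero.comp (Real.tendsto_sqrt_atTop.comp
    tendsto_natCast_atTop_atTop)).mul_const R

theorem norm_inv_sqrt_smul_le {n : ℕ} {u : EuclideanSpace ℝ (Fin p)} {R : ℝ} (hu : ‖u‖ ≤ R) :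
    ‖(√(n : ℝ))⁻¹ • u‖ ≤ (√(n : ℝ))⁻¹ * R := by
  rw [norm_smul, Real.norm_of_nonneg (by positivity)]
  gcongr

theorem eventually_norm_remainder_lt (hd : Continuous (gradient g)) {R ρ : ℝ} (hR : 0 < R)
    (hρ : 0 < ρ) : ∃ η > 0, ∀ᶠ n in atTop, ∀ ω ∈ goodEvent v g β₀ X ε C uHat R η n,
      ‖remainder g β₀ X C uHat n ω‖ < ρ := by
  -- With this `η`, the covariance term is at most `η * R = ρ / 2`; continuity of the gradient at
  -- `β₀` takes care of the other half.
  refine ⟨ρ / (2 * R), by positivity, ?_⟩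
  obtain ⟨r, hr, hball⟩ := Metric.continuousAt_iff.1 hd.continuousAt (ρ / 2) (half_pos hρ)
  filter_upwards [(tendsto_inv_sqrt_mul R).eventually_lt_const hr] with n hn ω hω
  obtain ⟨-, hu, hD⟩ := hω
  have h1 : ‖gradient g β₀ - gradient g (β₀ + (√(n : ℝ))⁻¹ • uHat n ω)‖ < ρ / 2 := by
    rw [← dist_eq_norm, dist_comm]
    refine hball ?_
    rw [dist_eq_norm, add_sub_cancel_left]
    exact (norm_inv_sqrt_smul_le hu).trans_lt hn
  have h2 : ‖Matrix.toEuclideanCLM (𝕜 := ℝ) C (uHat n ω)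
      - Matrix.toEuclideanCLM (𝕜 := ℝ) (empCov (fun i => X i ω) n) (uHat n ω)‖ ≤ ρ / 2 := by
    rw [← sub_apply]
    refine (ContinuousLinearMap.le_of_opNorm_le_of_le _ hD hu).trans_eq ?_
    field_simp
  exact (norm_add_le _ _).trans_lt (by linarith)

/-- The bound `‖uHat n ω‖ ≤ R` puts `β₀ + uHat/√n` in the neighbourhood where active sets are
determined by the increment, uniformly over the event, and positive scaling does not change them.
The limiting inclusion thus holds exactly, the whole error being carried by the datum. -/
theorem eventually_sub_mem_dominatedSet (hd : Differentiable ℝ g) (R η : ℝ) :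
    ∀ᶠ n in atTop, ∀ ω ∈ goodEvent v g β₀ X ε C uHat R η n,
      score (fun i => X i ω) (fun i => ε i ω) n - gradient g β₀ + remainder g β₀ X C uHat n ω
          - Matrix.toEuclideanCLM (𝕜 := ℝ) C (uHat n ω) ∈
        dominatedSet v (argmaxOn v (argmaxOn v Finset.univ β₀) (uHat n ω)) := by
  obtain ⟨r, hr, hball⟩ := Metric.eventually_nhds_iff.1 (eventually_argmaxOn_add v Finset.univ β₀)
  filter_upwards [(tendsto_inv_sqrt_mul R).eventually_lt_const hr, eventually_gt_atTop 0]
    with n hn hn0 ω hω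
  obtain ⟨hmin, hu, -⟩ := hω
  have h1 := sub_mem_dominatedSet_of_isMinOn_rescaledObjective hn0 hd hmin
  rw [hball (by rw [dist_zero_right]; exact (norm_inv_sqrt_smul_le hu).trans_lt hn),
    argmaxOn_smul (by positivity)] at h1
  convert h1 using 1
  rw [remainder]
  abel

variable [MeasurableSpace Ω] {P : Measure Ω}

/-- `R` must be fixed before `η`: the closeness needed to make the remainder small depends on `R`.
-/
theorem exists_eventually_measure_compl_goodEvent_le (hC : C.PosDef)
    (hg : ConvexOn ℝ Set.univ g) (hd : Differentiable ℝ g)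
    (hscore : ∀ δ : ENNReal, 0 < δ → ∃ R > 0, ∀ᶠ n in atTop,
      P {ω | R ≤ ‖score (fun i => X i ω) (fun i => ε i ω) n‖} < δ)
    (hcov : ∀ η : ℝ, 0 < η → Tendsto (fun n => P {ω | η ≤ ‖Matrix.toEuclideanCLM (𝕜 := ℝ) C
      - Matrix.toEuclideanCLM (𝕜 := ℝ) (empCov (fun i => X i ω) n)‖}) atTop (𝓝 0))
    (huHat : ∀ n, ∀ᵐ ω ∂P,
      (∃ u, IsMinOn (rescaledObjective (maxFun (piece v g)) β₀
        (fun i => X i ω) (fun i => ε i ω) n) Set.univ u) →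
      IsMinOn (rescaledObjective (maxFun (piece v g)) β₀
        (fun i => X i ω) (fun i => ε i ω) n) Set.univ (uHat n ω))
    {δ : ENNReal} (hδ : 0 < δ) :
    ∃ R > 0, ∀ η > 0, ∀ᶠ n in atTop, P (goodEvent v g β₀ X ε C uHat R η n)ᶜ ≤ δ := by
  obtain ⟨c, hc, hcC⟩ := exists_pos_mul_norm_sq_le_inner hC
  obtain ⟨i, hi⟩ := argmaxOn_nonempty (v := v) Finset.univ_nonempty β₀
  obtain ⟨R, hR, hRn⟩ := hscore (δ / 2) (ENNReal.half_pos hδ.ne')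
  -- This is the norm bound for minimisers with coercivity constant `c / 2`, the constant left to
  -- `C_n` once it is `c / 2`-close to `C`.
  refine ⟨2 / (c / 2) * (R + ‖v i + gradient g β₀‖), by positivity, fun η hη => ?_⟩
  have hη' : 0 < min η (c / 2) := lt_min hη (by positivity)
  filter_upwards [hRn, (hcov _ hη').eventually_lt_const (ENNReal.half_pos hδ.ne'),
    eventually_gt_atTop 0] with n h1 h2 hn
  have hnull := ae_iff.1 (huHat n)
  refine (measure_mono fun ω hω => ?_).trans (((measure_union_le _ _).trans
    (add_le_add ((measure_union_le _ _).trans (add_le_add h1.le h2.le)) hnull.le)).trans_eq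
    (by rw [add_zero, ENNReal.add_halves]))
  by_contra hnot
  simp only [Set.mem_union, Set.mem_ofPred_eq, not_or, not_le, not_not] at hnot
  obtain ⟨⟨hW, hD⟩, hmin⟩ := hnot
  have hM := half_mul_norm_sq_le_inner hcC (hD.le.trans (min_le_right _ _))
  have hu := hmin (exists_isMinOn_rescaledObjective hn hg hd (half_pos hc) hM)
  refine hω ⟨hu, ?_, hD.le.trans (min_le_left _ _)⟩
  refine (norm_le_of_isMinOn_rescaledObjective hn hg hd (half_pos hc) hM hi hu).trans ?_
  gcongr

theorem tendstoInMeasure_remainder [IsProbabilityMeasure P] (hd : Continuous (gradient g))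
    (hgood : ∀ δ : ENNReal, 0 < δ → ∃ R > 0, ∀ η > 0, ∀ᶠ n in atTop,
      P (goodEvent v g β₀ X ε C uHat R η n)ᶜ ≤ δ) :
    TendstoInMeasure P (remainder g β₀ X C uHat) atTop 0 := by
  rw [tendstoInMeasure_iff_norm]
  intro ρ hρ
  rw [ENNReal.tendsto_nhds_zero]
  intro δ hδ
  obtain ⟨R, hR, hRn⟩ := hgood δ hδ
  obtain ⟨η, hη, hrem⟩ := eventually_norm_remainder_lt (v := v) (β₀ := β₀) (X := X) (ε := ε)
    (C := C) (uHat := uHat) hd hR hρ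
  filter_upwards [hRn η hη, hrem] with n h1 h2
  refine (measure_mono fun ω hω hmem => ?_).trans h1
  have := h2 ω hmem
  simp only [Set.mem_ofPred_eq, Pi.zero_apply, sub_zero] at hω
  linarith

theorem aemeasurable_remainder (hd : Continuous (gradient g)) (hX : ∀ i, AEMeasurable (X i) P)
    (hu : ∀ n, AEMeasurable (uHat n) P) (n : ℕ) :
    AEMeasurable (remainder g β₀ X C uHat n) P := by
  have h1 : AEMeasurable (fun ω => gradient g (β₀ + (√(n : ℝ))⁻¹ • uHat n ω)) P :=
    hd.measurable.comp_aemeasurable (((hu n).const_smul (√(n : ℝ))⁻¹).const_add β₀)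
  have h2 : AEMeasurable (fun ω => Matrix.toEuclideanCLM (𝕜 := ℝ) C (uHat n ω)) P :=
    (Matrix.toEuclideanCLM (𝕜 := ℝ) C).continuous.measurable.comp_aemeasurable (hu n)
  exact (h1.const_sub _).add (h2.sub (aemeasurable_toEuclideanCLM_empCov hX (hu n) n))

theorem tendsto_measure_norm_sub_empCov [IsProbabilityMeasure P]
    (hX : ∀ i, AEMeasurable (X i) P)
    (hlim : ∀ᵐ ω ∂P, Tendsto (fun n => empCov (fun i => X i ω) n) atTop (𝓝 C))
    {η : ℝ} (hη : 0 < η) :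
    Tendsto (fun n => P {ω | η ≤ ‖Matrix.toEuclideanCLM (𝕜 := ℝ) C
      - Matrix.toEuclideanCLM (𝕜 := ℝ) (empCov (fun i => X i ω) n)‖}) atTop (𝓝 0) := by
  have hc : Continuous fun A : Fin p → Fin p → ℝ =>
      ‖Matrix.toEuclideanCLM (𝕜 := ℝ) C - Matrix.toEuclideanCLM (𝕜 := ℝ) (Matrix.of A)‖ := by
    have : Continuous fun A : Fin p → Fin p → ℝ =>
        Matrix.toEuclideanCLM (𝕜 := ℝ) (Matrix.of A) :=
      LinearMap.continuous_of_finiteDimensional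
        ((Matrix.toEuclideanCLM (n := Fin p) (𝕜 := ℝ)).toAlgEquiv.toLinearMap ∘ₗ
          (Matrix.ofLinearEquiv ℝ).toLinearMap)
    fun_prop
  have hcoord : ∀ i j, AEMeasurable (fun ω => X i ω j) P := fun i j =>
    (EuclideanSpace.proj (𝕜 := ℝ) j).continuous.measurable.comp_aemeasurable (hX i)
  have hmeas : ∀ n, AEMeasurable (fun ω => ‖Matrix.toEuclideanCLM (𝕜 := ℝ) C
      - Matrix.toEuclideanCLM (𝕜 := ℝ) (empCov (fun i => X i ω) n)‖) P := fun n => by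
    refine hc.measurable.comp_aemeasurable (f := fun ω j k => empCov (fun i => X i ω) n j k)
      (aemeasurable_pi_lambda _ fun j => aemeasurable_pi_lambda _ fun k => ?_)
    simp only [empCov_apply]
    exact (Finset.aemeasurable_fun_sum _ fun i _ => (hcoord i j).mul (hcoord i k)).div_const _
  have h := tendstoInMeasure_of_tendsto_ae (μ := P) (g := fun _ => (0 : ℝ))
    (fun n => (hmeas n).aestronglyMeasurable)
    (hlim.mono fun ω hω => tendsto_norm_sub_toEuclideanCLM hω)
  simpa using tendstoInMeasure_iff_norm.1 h η hη

end Estimator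

end PenPattern

end

/-! ### The main theorem -/

theorem mainTheorem8 {p N : ℕ} [NeZero N]
    -- the penalty `f = max_i (⟨v_i, ·⟩ + g)`
    (v : Fin N → EuclideanSpace ℝ (Fin p)) (g : EuclideanSpace ℝ (Fin p) → ℝ)
    (hg_smooth : ContDiff ℝ 1 g) (hg_convex : ConvexOn ℝ Set.univ g)
    (β₀ : EuclideanSpace ℝ (Fin p))
    -- the linear model: i.i.d. centered regressors and noise, independent of each other
    {Ω : Type*} [MeasurableSpace Ω] (P : Measure Ω) [IsProbabilityMeasure P]
    (X : ℕ → Ω → EuclideanSpace ℝ (Fin p)) (ε : ℕ → Ω → ℝ)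
    (C : Matrix (Fin p) (Fin p) ℝ) (σ : ℝ) (hC : C.PosDef) (hσ : 0 < σ)
    (hX_indep : iIndepFun X P) (hX_ident : ∀ i, IdentDistrib (X i) (X 0) P P)
    (hX_L2 : MemLp (X 0) 2 P) (hX_mean : ∫ ω, X 0 ω ∂P = 0)
    (hX_cov : ∀ j k, covariance (fun ω => X 0 ω j) (fun ω => X 0 ω k) P = C j k)
    (hε_indep : iIndepFun ε P) (hε_ident : ∀ i, IdentDistrib (ε i) (ε 0) P P)
    (hε_L2 : MemLp (ε 0) 2 P) (hε_mean : ∫ ω, ε 0 ω ∂P = 0)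
    (hε_var : variance (ε 0) P = σ ^ 2)
    (hXε : IndepFun (fun ω i => X i ω) (fun ω i => ε i ω) P)
    -- `uHat n` minimises the `n`-th rescaled objective, whenever that has a minimiser
    (uHat : ℕ → Ω → EuclideanSpace ℝ (Fin p)) (huHat_meas : ∀ n, AEMeasurable (uHat n) P)
    (huHat : ∀ n, ∀ᵐ ω ∂P,
      (∃ u, IsMinOn (PenPattern.rescaledObjective (PenPattern.maxFun (PenPattern.piece v g)) β₀
        (fun i => X i ω) (fun i => ε i ω) n) Set.univ u) →
      IsMinOn (PenPattern.rescaledObjective (PenPattern.maxFun (PenPattern.piece v g)) β₀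
        (fun i => X i ω) (fun i => ε i ω) n) Set.univ (uHat n ω))
    -- the limit variable `W ∼ N(0, σ² C)` and the minimiser of the limiting objective
    {Ω' : Type*} [MeasurableSpace Ω'] (P' : Measure Ω') [IsProbabilityMeasure P']
    (W : Ω' → EuclideanSpace ℝ (Fin p)) (hW : HasLaw W (multivariateGaussian 0 (σ ^ 2 • C)) P')
    (uLim : Ω' → EuclideanSpace ℝ (Fin p)) (huLim_meas : AEMeasurable uLim P')
    (huLim : ∀ᵐ ω ∂P',
      IsMinOn (PenPattern.limitObjective (PenPattern.maxFun (PenPattern.piece v g)) β₀ C (W ω))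
        Set.univ (uLim ω)) :
    (∀ K : Set (EuclideanSpace ℝ (Fin p)), Convex ℝ K →
      Tendsto (fun n => P {ω | uHat n ω ∈ K}) atTop (𝓝 (P' {ω | uLim ω ∈ K}))) ∧
    TendstoInDistribution (fun n ω => PenPattern.activeSet (PenPattern.piece v g) (uHat n ω))
      atTop (fun ω => PenPattern.activeSet (PenPattern.piece v g) (uLim ω)) (fun _ => P) P' ∧
    TendstoInDistribution (fun n ω => PenPattern.slopePattern (uHat n ω))
      atTop (fun ω => PenPattern.slopePattern (uLim ω)) (fun _ => P) P' := by
  have mX i := (hX_ident i).aemeasurable_fst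
  have hd : Differentiable ℝ g := hg_smooth.differentiable one_ne_zero
  have hgrad : Continuous (gradient g) :=
    (InnerProductSpace.toDual ℝ _).symm.continuous.comp (hg_smooth.continuous_fderiv one_ne_zero)
  have hclt := PenPattern.tendstoInDistribution_score hC hX_indep hX_ident hX_L2 hX_mean hX_cov
    hε_indep hε_ident hε_L2 hε_mean hε_var hXε hW
  have hlln := PenPattern.ae_tendsto_empCov hX_indep hX_ident hX_L2 hX_mean hX_cov
  have hgood : ∀ δ : ENNReal, 0 < δ → ∃ R > 0, ∀ η > 0, ∀ᶠ n in atTop,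
      P (PenPattern.goodEvent v g β₀ X ε C uHat R η n)ᶜ ≤ δ := fun δ hδ =>
    PenPattern.exists_eventually_measure_compl_goodEvent_le hC hg_convex hd
      (fun _ h => PenPattern.exists_eventually_measure_norm_lt hclt h)
      (fun _ h => PenPattern.tendsto_measure_norm_sub_empCov mX hlln h) huHat hδ
  -- Slutsky: the perturbed data converge in law to the datum of the limiting inclusion.
  have hZ : TendstoInDistribution
      (fun n ω => PenPattern.score (fun i => X i ω) (fun i => ε i ω) n - gradient g β₀
        + PenPattern.remainder g β₀ X C uHat n ω) atTop (fun ω => W ω - gradient g β₀)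
      (fun _ => P) P' := by
    have hshift := hclt.continuous_comp (g := fun w => w - gradient g β₀) (by fun_prop)
    refine tendstoInDistribution_of_tendstoInMeasure_sub _ _ hshift ?_ fun n =>
      (hshift.forall_aemeasurable n).add (PenPattern.aemeasurable_remainder hgrad mX huHat_meas n)
    have hrem := PenPattern.tendstoInMeasure_remainder hgrad hgood
    rw [tendstoInMeasure_iff_norm] at hrem ⊢
    simpa using hrem
  have hac : P'.map (fun ω => W ω - gradient g β₀) ≪ volume := by
    have h1 : P'.map (fun ω => W ω - gradient g β₀) =
        (multivariateGaussian 0 (σ ^ 2 • C)).map fun w => w - gradient g β₀ := by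
      rw [← hW.map_eq, AEMeasurable.map_map_of_aemeasurable (by fun_prop) hW.aemeasurable]
      rfl
    rw [h1, ← (measurePreserving_sub_right volume (gradient g β₀)).map_eq]
    exact (PenPattern.multivariateGaussian_absolutelyContinuous 0
      (hC.smul (sq_pos_of_pos hσ))).map (by fun_prop)
  have hpos : ∀ u : EuclideanSpace ℝ (Fin p), u ≠ 0 →
      0 < inner ℝ (Matrix.toEuclideanCLM (𝕜 := ℝ) C u) u := fun u hu => by
    obtain ⟨c, hc, h⟩ := PenPattern.exists_pos_mul_norm_sq_le_inner hC
    rw [real_inner_comm]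
    have := norm_pos_iff.2 hu
    exact (by positivity : 0 < c * ‖u‖ ^ 2).trans_le (h u)
  have hconv : ∀ K : Set (EuclideanSpace ℝ (Fin p)), Convex ℝ K →
      Tendsto (fun n => P {ω | uHat n ω ∈ K}) atTop (𝓝 (P' {ω | uLim ω ∈ K})) := by
    intro K hK
    set I := PenPattern.argmaxOn v Finset.univ β₀
    set A := PenPattern.shiftedImage v I (Matrix.toEuclideanCLM (𝕜 := ℝ) C) K
    have hA := PenPattern.tendsto_measure_mem_of_null_frontier hZ (A := A)
      (hac (PenPattern.addHaar_frontier_shiftedImage volume v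
        (PenPattern.argmaxOn_nonempty Finset.univ_nonempty β₀) _ hK))
    have hlim : P' {ω | W ω - gradient g β₀ ∈ A} = P' {ω | uLim ω ∈ K} := by
      -- The two events agree almost surely, which equates their outer probabilities even if neither
      -- is measurable.
      refine measure_congr ?_
      filter_upwards [huLim] with ω hω
      exact propext (PenPattern.mem_shiftedImage_iff hpos
        (PenPattern.sub_mem_dominatedSet_of_isMinOn_limitObjective hC.isHermitian (hd β₀) hω))
    rw [hlim] at hA
    refine PenPattern.tendsto_measure_of_eventually_iff (measure_ne_top _ _) hA fun δ hδ => ?_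
    obtain ⟨R, -, hR⟩ := hgood δ hδ
    -- The value `η = 1` is arbitrary: the inclusion uses only minimality and the bound `R`.
    refine ⟨PenPattern.goodEvent v g β₀ X ε C uHat R 1, ?_⟩
    filter_upwards [hR 1 one_pos, PenPattern.eventually_sub_mem_dominatedSet (v := v) (β₀ := β₀)
      (X := X) (ε := ε) (C := C) (uHat := uHat) hd R 1] with n h1 h2
    exact ⟨h1, fun ω hω => PenPattern.mem_shiftedImage_iff hpos (h2 ω hω)⟩
  refine ⟨hconv, ?_, ?_⟩
  · exact PenPattern.tendstoInDistribution_of_tendsto_singleton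
      (fun n => (PenPattern.measurable_activeSet v g).comp_aemeasurable (huHat_meas n))
      ((PenPattern.measurable_activeSet v g).comp_aemeasurable huLim_meas)
      fun J => hconv _ (PenPattern.convex_setOf_activeSet_eq v g J)
  · exact PenPattern.tendstoInDistribution_of_tendsto_singleton
      (fun n => PenPattern.measurable_slopePattern.comp_aemeasurable (huHat_meas n))
      (PenPattern.measurable_slopePattern.comp_aemeasurable huLim_meas)
      fun m => hconv _ (PenPattern.convex_setOf_slopePattern_eq m)
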